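/- Throughout, graphs are finite, simple and non-empty. A \emph{mixed unit interval graph} is the intersection graph of a family of unit-length intervals of the real line, each of which is closed, open, or half-open on either side. Two vertices $u,v$ of $G$ are \emph{twins} if they are adjacent and $N(u)\setminus\{v\}=N(v)\setminus\{u\}$; a \emph{bubble} of $G$ is a maximal set of pairwise twins. An \emph{extended bubble model} of $G$ assigns to each vertex $v$ a column $j(v)\in\mathbb N$, a row $i(v)\in\mathbb N$ and a quadrant, i.e. two bits telling whether $v$ is left-closed and whether $v$ is right-closed, such that distinct vertices in the same column are adjacent; if $j(u)=j(v)+1$, then $u,v$ are adjacent if and only if $i(u)<i(v)$, or $i(u)=i(v)$, $u$ is left-closed and $v$ is right-closed; and vertices whose columns differ by at least two are non-adjacent. The set of vertices with a given column, row and quadrant is a bubble of the model. Let $p(G)$ be the minimum, over all extended bubble models of $G$, of the maximum number of non-empty bubbles of the model in a column. A \emph{clique-width decomposition} $T$ of $G$ is an expression (viewed as a rooted binary tree) with value $G$, for some labelling, built from the operations: $\ell(v)$, a single vertex $v$ labelled $\ell$; disjoint union of vertex-disjoint labelled graphs; $\eta_{i,j}$, which connects all vertices labelled $i$ with all vertices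 labelled $j$ (for $i=j$ it makes the vertices labelled $i$ a clique); and $\rho_{i\to j}$, which replaces all labels $i$ by $j$. Let $\mathcal L(T)$ be the set of labels used by $T$; the \emph{width} of $T$ is $|\mathcal L(T)|$. For a node $t$, let $V_{t,\ell}$ be the set of vertices labelled $\ell$ in the value of the subexpression rooted at $t$. The decomposition $T$ is a \emph{$(1,1,1)$-clique-width decomposition} of $G$ if for every node $t$ there is a set $L_t\subseteq\mathcal L(T)$ of at most one label such that $G\big[\bigcup_{\ell\in\mathcal L(T)\setminus L_t}V_{t,\ell}\big]$ has independence number at most $1$, and $V_{t,\ell}$ meets at most one bubble of $G$ for every $\ell\in\mathcal L(T)\setminus L_t$. \textbf{Statement.} There is a polynomial-time algorithm (a random access machine with unit-cost addition, truncated subtraction and indirect addressing, whose number of steps is bounded by a polynomial in the number of vertices) that, given the adjacency matrix of a mixed unit interval graph $G$, outputs a $(1,1,1)$-clique-width decomposition of $G$ of width at most $2p(G)+1$. -/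

import Mathlib

noncomputable section

/-- `u` and `v` are equal, or twins: adjacent with `N(u) \ {v} = N(v) \ {u}`. -/
def SimpleGraph.IsTwin {V : Type*} (G : SimpleGraph V) (u v : V) : Prop :=
  u = v ∨ (G.Adj u v ∧ G.neighborSet u \ {v} = G.neighborSet v \ {u})

/-- The bubble (maximal set of twins) containing `v`. -/
def SimpleGraph.bubble {V : Type*} (G : SimpleGraph V) (v : V) : Set V :=
  {u | G.IsTwin v u}

/-- The number of bubbles of `G` that meet `U`. -/
def SimpleGraph.bubbleCount {V : Type*} (G : SimpleGraph V) (U : Set V) : ℕ :=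
  (G.bubble '' U).ncard

/-- Mixed unit interval graphs: intersection graphs of unit intervals of the real line,
each of which is closed, open, or half-open on either side. -/
def SimpleGraph.IsMixedUnitInterval {V : Type*} (G : SimpleGraph V) : Prop :=
  ∃ I : V → Set ℝ,
    (∀ v, ∃ x : ℝ, I v = Set.Icc x (x + 1) ∨ I v = Set.Ioo x (x + 1) ∨
      I v = Set.Ico x (x + 1) ∨ I v = Set.Ioc x (x + 1)) ∧
    ∀ u v, u ≠ v → (G.Adj u v ↔ (I u ∩ I v).Nonempty)

/-- An extended (2-dimensional) bubble model of `G`. The vertex `v` lies in column `col v` and row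
`row v`, and, inside the bubble at that position, in the quadrant given by the two Booleans
`leftClosed v`, `rightClosed v`. -/
structure ExtBubbleModel {V : Type*} (G : SimpleGraph V) where
  col : V → ℕ
  row : V → ℕ
  leftClosed : V → Bool
  rightClosed : V → Bool
  /-- Columns are cliques. -/
  adj_same : ∀ u v, u ≠ v → col u = col v → G.Adj u v
  /-- Adjacency between a column (containing `v`) and the next one (containing `u`). -/
  adj_next : ∀ u v, col u = col v + 1 →
    (G.Adj u v ↔ row u < row v ∨
      (row u = row v ∧ leftClosed u = true ∧ rightClosed v = true))
  /-- There are no edges between columns at distance at least two. -/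
  not_adj_far : ∀ u v, col v + 1 < col u → ¬ G.Adj u v

namespace ExtBubbleModel

variable {V : Type*} {G : SimpleGraph V}

/-- The position of a vertex: row, column and quadrant. -/
def place (B : ExtBubbleModel G) (v : V) : (ℕ × ℕ) × (Bool × Bool) :=
  ((B.row v, B.col v), (B.leftClosed v, B.rightClosed v))

/-- The number of non-empty bubbles `B^q_{i,j}` (`i` a row, `q` a quadrant) in column `j`. -/
def columnCount (B : ExtBubbleModel G) (j : ℕ) : ℕ :=
  (B.place '' {v | B.col v = j}).ncard

/-- The maximum number of non-empty bubbles in a column. -/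
def maxColumn [Fintype V] (B : ExtBubbleModel G) : ℕ :=
  (Finset.univ.image B.col).sup B.columnCount

end ExtBubbleModel

/-- The parameter `p(G)`: the least possible value, over all extended bubble models of `G`, of the
maximum number of non-empty bubbles in a column. -/
def SimpleGraph.bubbleP {V : Type*} [Fintype V] (G : SimpleGraph V) : ℕ :=
  sInf {k | ∃ B : ExtBubbleModel G, B.maxColumn = k}

/-- Clique-width expressions (equivalently, the rooted binary trees that represent them)
with labels in `ℕ`. -/
inductive CliqueExpr (V : Type*) where
  /-- one vertex `v` labelled `l` -/
  | vertex (l : ℕ) (v : V)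
  /-- disjoint union -/
  | union (a b : CliqueExpr V)
  /-- connect all vertices labelled `i` with all vertices labelled `j` -/
  | join (i j : ℕ) (e : CliqueExpr V)
  /-- replace all labels `i` by `j` -/
  | relabel (i j : ℕ) (e : CliqueExpr V)

namespace CliqueExpr

variable {V : Type*}

/-- The vertices of the value of an expression. -/
def verts : CliqueExpr V → Set V
  | vertex _ v => {v}
  | union a b => a.verts ∪ b.verts
  | join _ _ e => e.verts
  | relabel _ _ e => e.verts

open Classical in
/-- The label of a vertex in the value of an expression (only meaningful on `verts`). -/
def label : CliqueExpr V → V → ℕ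
  | vertex l _, _ => l
  | union a b, x => if x ∈ a.verts then a.label x else b.label x
  | join _ _ e, x => e.label x
  | relabel i j e, x => if e.label x = i then j else e.label x

/-- `V_{t,l}`: the vertices labelled `l` in the value of the expression. -/
def labelClass (t : CliqueExpr V) (l : ℕ) : Set V :=
  {v | v ∈ t.verts ∧ t.label v = l}

/-- The edges of the value of an expression. For `i = j`, the operation `join i i`
makes the vertices labelled `i` a clique. -/
def graph : CliqueExpr V → SimpleGraph V
  | vertex _ _ => ⊥
  | union a b => a.graph ⊔ b.graph
  | join i j e => e.graph ⊔
      SimpleGraph.fromRel (fun x y => x ∈ e.labelClass i ∧ y ∈ e.labelClass j)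
  | relabel _ _ e => e.graph

/-- Unions are taken of vertex-disjoint graphs only. -/
def WellFormed : CliqueExpr V → Prop
  | vertex _ _ => True
  | union a b => Disjoint a.verts b.verts ∧ a.WellFormed ∧ b.WellFormed
  | join _ _ e => e.WellFormed
  | relabel _ _ e => e.WellFormed

/-- The set of labels that an expression uses. -/
def labels : CliqueExpr V → Finset ℕ
  | vertex l _ => {l}
  | union a b => a.labels ∪ b.labels
  | join i j e => {i, j} ∪ e.labels
  | relabel i j e => {i, j} ∪ e.labels

/-- The number of labels that an expression uses. -/
def width (t : CliqueExpr V) : ℕ := t.labels.card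

/-- The nodes of the tree, each given as the subexpression rooted at it. -/
def nodes : CliqueExpr V → List (CliqueExpr V)
  | vertex l v => [vertex l v]
  | union a b => union a b :: (a.nodes ++ b.nodes)
  | join i j e => join i j e :: e.nodes
  | relabel i j e => relabel i j e :: e.nodes

/-- `T` is a clique-width decomposition of `G`: its value is `G`, with some labelling. -/
def IsDecomposition (T : CliqueExpr V) (G : SimpleGraph V) : Prop :=
  T.WellFormed ∧ T.verts = Set.univ ∧ T.graph = G

/-- `T` is an `(α, β, δ)`-clique-width decomposition of `G`. -/
def IsABDDecomposition (T : CliqueExpr V) (G : SimpleGraph V) (α β δ : ℕ) : Prop :=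
  T.IsDecomposition G ∧
  ∀ t ∈ T.nodes, ∃ L : Finset ℕ, L ⊆ T.labels ∧ L.card ≤ δ ∧
    (G.induce {v | v ∈ t.verts ∧ t.label v ∉ L}).indepNum ≤ α ∧
    ∀ l ∈ T.labels, l ∉ L → G.bubbleCount (t.labelClass l) ≤ β

/-- An expression as a word over `ℕ`, in reverse Polish notation. -/
def encode {n : ℕ} : CliqueExpr (Fin n) → List ℕ
  | vertex l v => [0, l, v.val]
  | union a b => a.encode ++ b.encode ++ [1]
  | join i j e => e.encode ++ [2, i, j]
  | relabel i j e => e.encode ++ [3, i, j]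

end CliqueExpr

/-- Programs of a random access machine. A program uses finitely many registers and finitely many
arrays (the indices `r`, `a`, `b`, `A` are constants in the program text), all of which hold natural
numbers; array cells are addressed through registers. The arithmetic operations are
addition and truncated subtraction. -/
inductive Ram where
  /-- `r := c` for a constant `c` -/
  | const (r c : ℕ)
  /-- `r := a + b` -/
  | plus (r a b : ℕ)
  /-- `r := a - b` (truncated) -/
  | minus (r a b : ℕ)
  /-- `r := A[a]` -/
  | load (r A a : ℕ)
  /-- `A[a] := r` -/
  | store (A a r : ℕ)
  /-- sequential composition -/
  | seq (p q : Ram)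
  /-- if register `r` is non-zero then `p` else `q` -/
  | cond (r : ℕ) (p q : Ram)
  /-- while register `r` is non-zero do `p` -/
  | loop (r : ℕ) (p : Ram)

namespace Ram

/-- The contents of registers and arrays. -/
structure State where
  reg : ℕ → ℕ
  arr : ℕ → ℕ → ℕ

/-- The state after writing `x` to register `r`. -/
def State.setReg (s : State) (r x : ℕ) : State :=
  { s with reg := Function.update s.reg r x }

/-- The state after writing `x` to cell `k` of array `A`. -/
def State.setArr (s : State) (A k x : ℕ) : State :=
  { s with arr := Function.update s.arr A (Function.update (s.arr A) k x) }

/-- `Exec p s s' t`: the program `p`, started in the state `s`, halts in the state `s'` after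
exactly `t` steps. Every elementary instruction and every test counts as one step. -/
inductive Exec : Ram → State → State → ℕ → Prop
  | const (r c : ℕ) (s : State) : Exec (.const r c) s (s.setReg r c) 1
  | plus (r a b : ℕ) (s : State) : Exec (.plus r a b) s (s.setReg r (s.reg a + s.reg b)) 1
  | minus (r a b : ℕ) (s : State) : Exec (.minus r a b) s (s.setReg r (s.reg a - s.reg b)) 1
  | load (r A a : ℕ) (s : State) : Exec (.load r A a) s (s.setReg r (s.arr A (s.reg a))) 1
  | store (A a r : ℕ) (s : State) : Exec (.store A a r) s (s.setArr A (s.reg a) (s.reg r)) 1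
  | seq {p q : Ram} {s s' s'' : State} {t t' : ℕ} :
      Exec p s s' t → Exec q s' s'' t' → Exec (.seq p q) s s'' (t + t')
  | condTrue {r : ℕ} {p q : Ram} {s s' : State} {t : ℕ} :
      s.reg r ≠ 0 → Exec p s s' t → Exec (.cond r p q) s s' (t + 1)
  | condFalse {r : ℕ} {p q : Ram} {s s' : State} {t : ℕ} :
      s.reg r = 0 → Exec q s s' t → Exec (.cond r p q) s s' (t + 1)
  | loopDone {r : ℕ} {p : Ram} {s : State} :
      s.reg r = 0 → Exec (.loop r p) s s 1
  | loopStep {r : ℕ} {p : Ram} {s s' s'' : State} {t t' : ℕ} :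
      s.reg r ≠ 0 → Exec p s s' t → Exec (.loop r p) s' s'' t' →
      Exec (.loop r p) s s'' (t + t' + 1)

open Classical in
/-- The initial state for an input graph: register `0` holds the number `n` of vertices,
array `0` holds the adjacency matrix row by row, and everything else is zero. -/
def graphInput {n : ℕ} (G : SimpleGraph (Fin n)) : State where
  reg r := if r = 0 then n else 0
  arr A k := if A = 0 ∧ ∃ i j : Fin n, k = i.val * n + j.val ∧ G.Adj i j then 1 else 0

/-- The state `s` holds the output word `w`: register `0` holds the length of `w`, and the
entries of `w` are in the first cells of array `1`. -/
def HoldsOutput (s : State) (w : List ℕ) : Prop :=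
  s.reg 0 = w.length ∧ ∀ k (h : k < w.length), s.arr 1 k = w[k]

end Ram

end

/-! Write "a lies left of b" for the relation between non-adjacent vertices of an interval model. If
b and c are adjacent and a is adjacent to neither, then b and c lie on the same side of a. This
forcing between ordered non-adjacent pairs generates implication classes, each lying entirely in the
left-of relation or entirely in its reverse. From every class and its reversal, `lexOrient` keeps
the one whose least pair is smaller in lexicographic order. The triangle lemma `SameClass.triangle`
shows that this choice has no cyclic triangle (`IsClassMin.not_cyclic`), so it is a transitive
orientation of the complement of G, found without any interval model. As G has no induced
four-cycle, the predecessor sets form a chain. Sorting the vertices by their number of predecessors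
thus behaves like sorting by left ends: a vertex adjacent to a later one is adjacent to everything
in between (`IsClassMin.adj_of_card_le`).

Along this order, colour first-fit, ignoring conflicts between twins. Twins receive equal colours,
and adjacent vertices of equal colour are twins. A vertex together with its earlier neighbours is a
clique K on which all colours up to its own appear, so its colour is less than the number of bubbles
meeting K. In an extended bubble model a clique occupies at most two consecutive columns, and
vertices at one place are twins; hence K meets at most 2 p(G) bubbles
(`IsFirstFit.lt_two_mul_bubbleP`).

The expression adds the vertices in this order. Colours shifted by one serve as labels, and label 0
collects the vertices that are finished. Before u is added, the non-neighbours of u are relabelled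
0; the remaining live vertices and u form a clique, and a nonzero label on a clique lies in a single
bubble. So {0} is the exceptional set at every node, and there are at most 2 p(G) + 1 labels
(`Relabelled.step`, `Relabelled.union`, `Built.isABDDecomposition`).

For the running time, the algorithm is written in a language whose loops and sums all have length n.
Compiling it to the machine gives a polynomial bound by structural recursion (`Cmd.exec_compile`).
The output is in postfix notation, so extending the expression only means appending to the word. -/

namespace SimpleGraph

/-! ### Twins and bubbles -/

variable {V : Type*} {G : SimpleGraph V}

/-- Twins are vertices with equal closed neighbourhoods; in this form the relation is visibly an
equivalence. -/
theorem isTwin_iff {u v : V} :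
    G.IsTwin u v ↔ ∀ w, (w = u ∨ G.Adj u w) ↔ (w = v ∨ G.Adj v w) := by
  constructor
  · rintro (rfl | ⟨huv, h⟩) w
    · rfl
    · have hw := Set.ext_iff.1 h w
      simp only [Set.mem_sdiff, mem_neighborSet, Set.mem_singleton_iff] at hw
      by_cases h1 : w = u
      · subst h1; simp [huv.symm]
      · by_cases h2 : w = v
        · subst h2; simp [huv]
        · tauto
  · intro h
    by_cases huv : u = v
    · exact Or.inl huv
    · have h1 : G.Adj v u := by simpa [huv] using h u
      refine Or.inr ⟨h1.symm, ?_⟩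
      ext w
      have hw := h w
      simp only [Set.mem_sdiff, mem_neighborSet, Set.mem_singleton_iff]
      constructor
      · rintro ⟨h2, h3⟩
        exact ⟨by tauto, fun h4 => G.loopless.irrefl u (h4 ▸ h2)⟩
      · rintro ⟨h2, h3⟩
        exact ⟨by tauto, fun h4 => G.loopless.irrefl v (h4 ▸ h2)⟩

theorem IsTwin.refl (u : V) : G.IsTwin u u := Or.inl rfl

theorem IsTwin.symm {u v : V} (h : G.IsTwin u v) : G.IsTwin v u :=
  isTwin_iff.2 fun w => (isTwin_iff.1 h w).symm

theorem IsTwin.trans {u v w : V} (h : G.IsTwin u v) (h' : G.IsTwin v w) : G.IsTwin u w :=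
  isTwin_iff.2 fun x => (isTwin_iff.1 h x).trans (isTwin_iff.1 h' x)

theorem IsTwin.adj_iff {u v w : V} (h : G.IsTwin u v) (hu : w ≠ u) (hv : w ≠ v) :
    G.Adj u w ↔ G.Adj v w := by
  simpa [hu, hv] using isTwin_iff.1 h w

theorem bubble_eq_iff {u v : V} : G.bubble u = G.bubble v ↔ G.IsTwin u v := by
  constructor
  · intro h
    have : v ∈ G.bubble u := h ▸ IsTwin.refl v
    exact this
  · intro h
    ext w
    exact ⟨fun h' => h.symm.trans h', fun h' => h.trans h'⟩

theorem bubbleCount_le_one {U : Set V} (h : ∀ u ∈ U, ∀ v ∈ U, G.IsTwin u v) :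
    G.bubbleCount U ≤ 1 := by
  have hs : (G.bubble '' U).Subsingleton := by
    rintro _ ⟨u, hu, rfl⟩ _ ⟨v, hv, rfl⟩
    exact bubble_eq_iff.2 (h u hu v hv)
  exact (Set.ncard_le_one_iff hs.finite).2 fun ha hb => hs ha hb

theorem indepNum_induce_le_one {U : Set V} (h : ∀ u ∈ U, ∀ v ∈ U, u ≠ v → G.Adj u v) :
    (G.induce U).indepNum ≤ 1 := by
  refine csSup_le' ?_
  rintro k ⟨s, hs⟩
  rw [← hs.card_eq]
  refine Finset.card_le_one.2 fun a ha b hb => ?_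
  by_contra hab
  exact hs.isIndepSet ha hb hab (by
    simpa using h a a.2 b b.2 (fun h' => hab (Subtype.ext h')))

end SimpleGraph

/-! ### Cliques in extended bubble models -/

namespace ExtBubbleModel

variable {V : Type*} {G : SimpleGraph V} (B : ExtBubbleModel G)

/-- Adjacency to any third vertex is decided by columns, rows and closedness bits alone. By symmetry
one inclusion of closed neighbourhoods suffices. -/
theorem isTwin_of_place_eq {u v : V} (h : B.place u = B.place v) : G.IsTwin u v := by
  simp only [place, Prod.mk.injEq] at h
  obtain ⟨⟨hr, hc⟩, hl, hq⟩ := h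
  have key : ∀ a b w : V, B.row a = B.row b → B.col a = B.col b →
      B.leftClosed a = B.leftClosed b → B.rightClosed a = B.rightClosed b →
      (w = a ∨ G.Adj a w) → (w = b ∨ G.Adj b w) := by
    intro a b w hr hc hl hq haw
    by_cases hwb : w = b
    · exact Or.inl hwb
    right
    rcases haw with rfl | haw
    · exact (B.adj_same _ _ hwb hc).symm
    rcases lt_trichotomy (B.col a) (B.col w) with h1 | h1 | h1
    · rcases Nat.lt_or_ge (B.col a + 1) (B.col w) with h2 | h2
      · exact absurd haw.symm (B.not_adj_far _ _ h2)
      · have h3 : B.col w = B.col a + 1 := by omega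
        have h4 := (B.adj_next w a h3).1 haw.symm
        refine ((B.adj_next w b (by omega)).2 ?_).symm
        rwa [hr, hq] at h4
    · exact B.adj_same _ _ (Ne.symm hwb) (by omega)
    · rcases Nat.lt_or_ge (B.col w + 1) (B.col a) with h2 | h2
      · exact absurd haw (B.not_adj_far _ _ h2)
      · have h3 : B.col a = B.col w + 1 := by omega
        have h4 := (B.adj_next a w h3).1 haw
        refine (B.adj_next b w (by omega)).2 ?_
        rwa [hr, hl] at h4
  exact SimpleGraph.isTwin_iff.2 fun w =>
    ⟨key u v w hr hc hl hq, key v u w hr.symm hc.symm hl.symm hq.symm⟩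

theorem columnCount_le_maxColumn [Fintype V] (j : ℕ) : B.columnCount j ≤ B.maxColumn := by
  by_cases hj : ∃ v, B.col v = j
  · obtain ⟨v, rfl⟩ := hj
    exact Finset.le_sup (f := B.columnCount) (Finset.mem_image_of_mem _ (Finset.mem_univ v))
  · have : {v | B.col v = j} = ∅ := Set.eq_empty_iff_forall_notMem.2 fun v hv => hj ⟨v, hv⟩
    simp [columnCount, this]

/-- Columns at distance two or more are non-adjacent, so a clique lies in its leftmost column and
the next one. Each place contributes at most one bubble of the graph. -/
theorem bubbleCount_le [Fintype V] {K : Set V} (hK : G.IsClique K) :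
    G.bubbleCount K ≤ 2 * B.maxColumn := by
  classical
  rcases K.eq_empty_or_nonempty with rfl | hne
  · simp [SimpleGraph.bubbleCount]
  obtain ⟨v₀, hv₀, hmin⟩ := Set.exists_min_image K B.col K.toFinite hne
  set j := B.col v₀
  have hcol : ∀ v ∈ K, B.col v = j ∨ B.col v = j + 1 := by
    intro v hv
    have h1 := hmin v hv
    by_contra hcon
    have h2 : B.col v₀ + 1 < B.col v := by omega
    refine B.not_adj_far _ _ h2 (hK hv hv₀ ?_)
    rintro rfl
    omega
  have h1 : G.bubbleCount K ≤ (B.place '' K).ncard := by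
    have hex : ∀ p ∈ B.place '' K, ∃ v ∈ K, B.place v = p := fun p hp => hp
    have : Nonempty V := ⟨v₀⟩
    choose! f hf using hex
    have : G.bubble '' K ⊆ (fun p => G.bubble (f p)) '' (B.place '' K) := by
      rintro _ ⟨v, hv, rfl⟩
      refine ⟨B.place v, ⟨v, hv, rfl⟩, ?_⟩
      exact SimpleGraph.bubble_eq_iff.2
        (B.isTwin_of_place_eq (hf _ ⟨v, hv, rfl⟩).2)
    exact (Set.ncard_le_ncard this (Set.toFinite _)).trans (Set.ncard_image_le (Set.toFinite _))
  have h2 : B.place '' K ⊆ B.place '' {v | B.col v = j} ∪ B.place '' {v | B.col v = j + 1} := by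
    rintro _ ⟨v, hv, rfl⟩
    rcases hcol v hv with h | h
    · exact Or.inl ⟨v, h, rfl⟩
    · exact Or.inr ⟨v, h, rfl⟩
  calc G.bubbleCount K ≤ (B.place '' K).ncard := h1
    _ ≤ _ := Set.ncard_le_ncard h2 (Set.toFinite _)
    _ ≤ B.columnCount j + B.columnCount (j + 1) := Set.ncard_union_le _ _
    _ ≤ B.maxColumn + B.maxColumn :=
      add_le_add (B.columnCount_le_maxColumn j) (B.columnCount_le_maxColumn (j + 1))
    _ = 2 * B.maxColumn := by ring

end ExtBubbleModel

/-! ### From interval models to bubble models and the left-of relation -/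

namespace SimpleGraph

variable {V : Type*} {G : SimpleGraph V}

/-- A mixed unit interval is described by its left end and the two closedness bits. -/
theorem IsMixedUnitInterval.exists_ends (h : G.IsMixedUnitInterval) :
    ∃ (x : V → ℝ) (l r : V → Bool), ∀ u v, u ≠ v →
      (G.Adj u v ↔ (x u < x v + 1 ∨ (x u = x v + 1 ∧ l u = true ∧ r v = true)) ∧
        (x v < x u + 1 ∨ (x v = x u + 1 ∧ l v = true ∧ r u = true))) := by
  obtain ⟨I, hI, hadj⟩ := h
  choose x hx using hI
  have hends : ∀ v, ∃ l r : Bool, ∀ y, y ∈ I v ↔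
      (x v < y ∨ (x v = y ∧ l = true)) ∧ (y < x v + 1 ∨ (y = x v + 1 ∧ r = true)) := by
    intro v
    rcases hx v with h | h | h | h
    · exact ⟨true, true, fun y => by simp [h, le_iff_lt_or_eq]⟩
    · exact ⟨false, false, fun y => by simp [h]⟩
    · exact ⟨true, false, fun y => by simp [h, le_iff_lt_or_eq]⟩
    · exact ⟨false, true, fun y => by simp [h, le_iff_lt_or_eq]⟩
  choose l r hlr using hends
  refine ⟨x, l, r, fun u v huv => ?_⟩
  rw [hadj u v huv]
  constructor
  · rintro ⟨y, hu, hv⟩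
    rw [hlr] at hu hv
    obtain ⟨hu1, hu2⟩ := hu
    obtain ⟨hv1, hv2⟩ := hv
    constructor
    · rcases hu1 with hu1 | ⟨hu1, hl⟩
      · left; rcases hv2 with h | ⟨h, -⟩ <;> linarith
      · rcases hv2 with h | ⟨h, hr⟩
        · left; linarith
        · right; exact ⟨by linarith, hl, hr⟩
    · rcases hv1 with hv1 | ⟨hv1, hl⟩
      · left; rcases hu2 with h | ⟨h, -⟩ <;> linarith
      · rcases hu2 with h | ⟨h, hr⟩
        · left; linarith
        · right; exact ⟨by linarith, hl, hr⟩
  · rintro ⟨h1, h2⟩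
    rcases h1 with h1 | ⟨h1, hl, hr⟩
    · rcases h2 with h2 | ⟨h2, hl, hr⟩
      -- The overlap runs from the larger left end to the smaller right end and has positive length
      -- here; its midpoint avoids all questions of closedness. In the two remaining cases the only
      -- common point is the shared end.
      · refine ⟨(max (x u) (x v) + min (x u) (x v) + 1) / 2, ?_, ?_⟩ <;> rw [hlr] <;>
          refine ⟨Or.inl ?_, Or.inl ?_⟩ <;>
          rcases le_total (x u) (x v) with h | h <;> simp only [h, max_eq_left, max_eq_right,
            min_eq_left, min_eq_right] <;> linarith
      · refine ⟨x v, ?_, ?_⟩ <;> rw [hlr]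
        · exact ⟨Or.inl (by linarith), Or.inr ⟨h2, hr⟩⟩
        · exact ⟨Or.inr ⟨rfl, hl⟩, Or.inl (by linarith)⟩
    · refine ⟨x u, ?_, ?_⟩ <;> rw [hlr]
      · exact ⟨Or.inr ⟨rfl, hl⟩, Or.inl (by linarith)⟩
      · exact ⟨Or.inl (by linarith), Or.inr ⟨h1, hr⟩⟩

/-- Split the left end into integer and fractional part: the floor gives the column, the fractional
part the row. For unit intervals in consecutive columns, adjacency then compares fractional parts,
with the closedness bits deciding ties. Existence matters because the infimum defining `bubbleP`
would be 0 over an empty set. -/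
theorem IsMixedUnitInterval.nonempty_extBubbleModel [Finite V] (h : G.IsMixedUnitInterval) :
    Nonempty (ExtBubbleModel G) := by
  classical
  have := Fintype.ofFinite V
  obtain ⟨x, l, r, hadj⟩ := h.exists_ends
  obtain ⟨m, hm⟩ : ∃ m : ℤ, ∀ v, m ≤ ⌊x v⌋ := by
    obtain ⟨m, hm⟩ := (Set.finite_range fun v => ⌊x v⌋).bddBelow
    exact ⟨m, fun v => hm ⟨v, rfl⟩⟩
  -- The fractional parts are replaced by their ranks among the distinct values that occur, which
  -- preserves both order and equality.
  let row : V → ℕ := fun v =>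
    ((Finset.univ.image fun v => Int.fract (x v)).filter fun y => y < Int.fract (x v)).card
  have hrow_lt : ∀ u v, Int.fract (x u) < Int.fract (x v) → row u < row v := by
    intro u v huv
    refine Finset.card_lt_card (Finset.ssubset_iff_of_subset ?_ |>.2 ⟨Int.fract (x u), ?_, ?_⟩)
    · intro y hy
      rw [Finset.mem_filter] at hy ⊢
      exact ⟨hy.1, hy.2.trans huv⟩
    · rw [Finset.mem_filter]
      exact ⟨Finset.mem_image_of_mem _ (Finset.mem_univ u), huv⟩
    · simp
  have hrow_eq : ∀ u v, Int.fract (x u) = Int.fract (x v) → row u = row v := by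
    intro u v huv
    simp only [row, huv]
  have hlt : ∀ u v, row u < row v ↔ Int.fract (x u) < Int.fract (x v) := by
    intro u v
    refine ⟨fun h => ?_, hrow_lt u v⟩
    by_contra hcon
    rcases (not_lt.1 hcon).lt_or_eq with h1 | h1
    · exact absurd (hrow_lt v u h1) (by omega)
    · exact absurd (hrow_eq v u h1) (by omega)
  have heq : ∀ u v, row u = row v ↔ Int.fract (x u) = Int.fract (x v) := by
    intro u v
    refine ⟨fun h => ?_, hrow_eq u v⟩
    rcases lt_trichotomy (Int.fract (x u)) (Int.fract (x v)) with h1 | h1 | h1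
    · exact absurd (hrow_lt u v h1) (by omega)
    · exact h1
    · exact absurd (hrow_lt v u h1) (by omega)
  have hdec : ∀ v, x v = ⌊x v⌋ + Int.fract (x v) := fun v => (Int.floor_add_fract _).symm
  have h0 : ∀ v, 0 ≤ Int.fract (x v) := fun v => Int.fract_nonneg _
  have h1 : ∀ v, Int.fract (x v) < 1 := fun v => Int.fract_lt_one _
  refine ⟨⟨fun v => (⌊x v⌋ - m).toNat, row, l, r, ?_, ?_, ?_⟩⟩
  · intro u v huv hc
    have hc' : ⌊x u⌋ = ⌊x v⌋ := by
      have := hm u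
      have := hm v
      omega
    have hc'' : (⌊x u⌋ : ℝ) = ⌊x v⌋ := by exact_mod_cast hc'
    rw [hadj u v huv]
    have := hdec u
    have := hdec v
    have := h0 u
    have := h0 v
    have := h1 u
    have := h1 v
    exact ⟨Or.inl (by linarith), Or.inl (by linarith)⟩
  · intro u v hc
    have hc' : ⌊x u⌋ = ⌊x v⌋ + 1 := by
      have := hm u
      have := hm v
      omega
    have hc'' : (⌊x u⌋ : ℝ) = ⌊x v⌋ + 1 := by exact_mod_cast hc'
    have huv : u ≠ v := by
      rintro rfl
      omega
    have e1 := hdec u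
    have e2 := hdec v
    have := h0 u
    have := h0 v
    have := h1 u
    have := h1 v
    have k1 : x u < x v + 1 ↔ Int.fract (x u) < Int.fract (x v) := by
      constructor <;> intro h <;> linarith
    have k2 : x u = x v + 1 ↔ Int.fract (x u) = Int.fract (x v) := by
      constructor <;> intro h <;> linarith
    have k3 : x v < x u + 1 := by linarith
    rw [hadj u v huv, hlt, heq, k1, k2]
    simp [k3]
  · intro u v hc hadj'
    have hc' : ⌊x v⌋ + 2 ≤ ⌊x u⌋ := by
      have := hm u
      have := hm v
      omega
    have hc'' : (⌊x v⌋ : ℝ) + 2 ≤ ⌊x u⌋ := by exact_mod_cast hc'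
    have := hdec u
    have := hdec v
    have := h0 u
    have := h1 v
    rcases ((hadj u v hadj'.ne).1 hadj').1 with h | ⟨h, -⟩ <;> linarith

theorem IsMixedUnitInterval.bubbleCount_le [Fintype V] (h : G.IsMixedUnitInterval) {K : Set V}
    (hK : G.IsClique K) : G.bubbleCount K ≤ 2 * G.bubbleP := by
  obtain ⟨B₀⟩ := h.nonempty_extBubbleModel
  obtain ⟨B, hB⟩ := Nat.sInf_mem (s := {k | ∃ B : ExtBubbleModel G, B.maxColumn = k}) ⟨_, B₀, rfl⟩
  have := B.bubbleCount_le hK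
  rw [hB] at this
  exact this

/-- The consequences of having an interval model that the ordering algorithm relies on: a
relation "wholly to the left of" and the absence of induced four-cycles. -/
theorem IsMixedUnitInterval.exists_left (h : G.IsMixedUnitInterval) :
    ∃ L : V → V → Prop,
      (∀ u v, L u v → ¬ L v u) ∧
      (∀ u v, u ≠ v → ¬ G.Adj u v → L u v ∨ L v u) ∧
      (∀ a b c, L a b → a ≠ c → ¬ G.Adj a c → G.Adj b c → L a c) ∧
      (∀ a b c, L b a → a ≠ c → ¬ G.Adj a c → G.Adj b c → L c a) ∧
      ∀ x b a y, G.Adj x b → G.Adj b a → G.Adj a y → G.Adj y x → x ≠ a → ¬ G.Adj x a → y ≠ b →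
        G.Adj y b := by
  obtain ⟨I, hI, hadj⟩ := h
  have hne : ∀ v, (I v).Nonempty := by
    intro v
    obtain ⟨x, h | h | h | h⟩ := hI v <;> rw [h] <;> simp
  have hoc : ∀ v, (I v).OrdConnected := by
    intro v
    obtain ⟨x, h | h | h | h⟩ := hI v <;> rw [h] <;> infer_instance
  let L : V → V → Prop := fun u v => ∀ x ∈ I u, ∀ y ∈ I v, x < y
  have hasymm : ∀ u v, L u v → ¬ L v u := by
    intro u v h1 h2
    obtain ⟨x, hx⟩ := hne u
    obtain ⟨y, hy⟩ := hne v
    exact lt_asymm (h1 x hx y hy) (h2 y hy x hx)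
  have htot : ∀ u v, u ≠ v → ¬ G.Adj u v → L u v ∨ L v u := by
    intro u v huv hnadj
    rw [hadj u v huv] at hnadj
    by_contra! hcon
    obtain ⟨h1, h2⟩ := hcon
    simp only [L, not_forall, not_lt] at h1 h2
    obtain ⟨x, hx, y, hy, hyx⟩ := h1
    obtain ⟨y', hy', x', hx', hxy'⟩ := h2
    apply hnadj
    -- Here x' ≤ y' and y ≤ x, with x, x' in `I u` and y, y' in `I v`; order-convexity of both sets
    -- yields a common point.
    rcases le_total y' y with h | h
    · exact ⟨y, (hoc u).out hx' hx ⟨hxy'.trans h, hyx⟩, hy⟩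
    · rcases le_total y' x with h' | h'
      · exact ⟨y', (hoc u).out hx' hx ⟨hxy', h'⟩, hy'⟩
      · exact ⟨x, hx, (hoc v).out hy hy' ⟨hyx, h'⟩⟩
  refine ⟨L, hasymm, htot, ?_, ?_, ?_⟩
  · intro a b c hab hac hnac hbc
    refine (htot a c hac hnac).resolve_right fun hca => ?_
    obtain ⟨z, hzb, hzc⟩ := (hadj b c hbc.ne).1 hbc
    obtain ⟨x, hx⟩ := hne a
    exact lt_asymm (hab x hx z hzb) (hca z hzc x hx)
  · intro a b c hba hac hnac hbc
    refine (htot a c hac hnac).resolve_left fun hac' => ?_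
    obtain ⟨z, hzb, hzc⟩ := (hadj b c hbc.ne).1 hbc
    obtain ⟨x, hx⟩ := hne a
    exact lt_asymm (hba z hzb x hx) (hac' x hx z hzc)
  · intro x b a y hxb hba hay hyx hxa hnxa hyb
    by_contra hnyb
    obtain ⟨p, hpx, hpb⟩ := (hadj x b hxb.ne).1 hxb
    obtain ⟨q, hqb, hqa⟩ := (hadj b a hba.ne).1 hba
    obtain ⟨r, hra, hry⟩ := (hadj a y hay.ne).1 hay
    obtain ⟨s, hsy, hsx⟩ := (hadj y x hyx.ne).1 hyx
    -- Both diagonals of the four-cycle would be ordered from left to right. For each choice of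
    -- directions, two of the four points on the sides would each have to precede the other.
    rcases htot x a hxa hnxa with h | h <;> rcases htot y b hyb hnyb with h' | h'
    · exact lt_asymm (h p hpx r hra) (h' r hry p hpb)
    · exact lt_asymm (h s hsx q hqa) (h' q hqb s hsy)
    · exact lt_asymm (h q hqa s hsx) (h' s hsy q hqb)
    · exact lt_asymm (h r hra p hpx) (h' p hpb r hry)

end SimpleGraph

/-! ### Forcing classes of ordered non-adjacent pairs -/

namespace SimpleGraph

variable {V : Type*} {G : SimpleGraph V}

/-- Forcing between ordered pairs of distinct non-adjacent vertices: replacing one end by one of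
its neighbours. -/
inductive Forces (G : SimpleGraph V) : V × V → V × V → Prop
  | right {a b c : V} : a ≠ b → ¬ G.Adj a b → a ≠ c → ¬ G.Adj a c → G.Adj b c →
      Forces G (a, b) (a, c)
  | left {a b c : V} : a ≠ b → ¬ G.Adj a b → a ≠ c → ¬ G.Adj a c → G.Adj b c →
      Forces G (b, a) (c, a)

theorem Forces.symm {p q : V × V} (h : G.Forces p q) : G.Forces q p := by
  cases h with
  | right h1 h2 h3 h4 h5 => exact .right h3 h4 h1 h2 h5.symm
  | left h1 h2 h3 h4 h5 => exact .left h3 h4 h1 h2 h5.symm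

theorem Forces.swap {p q : V × V} (h : G.Forces p q) : G.Forces p.swap q.swap := by
  cases h with
  | right h1 h2 h3 h4 h5 => exact .left h1 h2 h3 h4 h5
  | left h1 h2 h3 h4 h5 => exact .right h1 h2 h3 h4 h5

/-- Two ordered pairs are in the same implication class. -/
def SameClass (G : SimpleGraph V) : V × V → V × V → Prop :=
  Relation.ReflTransGen G.Forces

theorem SameClass.refl (p : V × V) : G.SameClass p p := Relation.ReflTransGen.refl

theorem SameClass.symm {p q : V × V} (h : G.SameClass p q) : G.SameClass q p := by
  induction h with
  | refl => exact .refl _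
  | tail _ h ih => exact Relation.ReflTransGen.head h.symm ih

theorem SameClass.trans {p q r : V × V} (h : G.SameClass p q) (h' : G.SameClass q r) :
    G.SameClass p r := Relation.ReflTransGen.trans h h'

theorem Forces.sameClass {p q : V × V} (h : G.Forces p q) : G.SameClass p q :=
  Relation.ReflTransGen.single h

theorem SameClass.swap {p q : V × V} (h : G.SameClass p q) : G.SameClass p.swap q.swap := by
  induction h with
  | refl => exact .refl _
  | tail _ h ih => exact ih.trans h.swap.sameClass

theorem SameClass.nonadj {p q : V × V} (h : G.SameClass p q) (hp : p.1 ≠ p.2 ∧ ¬ G.Adj p.1 p.2) :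
    q.1 ≠ q.2 ∧ ¬ G.Adj q.1 q.2 := by
  induction h with
  | refl => exact hp
  | tail _ h ih =>
    cases h with
    | right h1 h2 h3 h4 h5 => exact ⟨h3, h4⟩
    | left h1 h2 h3 h4 h5 => exact ⟨h3.symm, fun h => h4 h.symm⟩

/-- Triangle lemma for implication classes. -/
theorem SameClass.triangle {a b c a' c' : V}
    (hab : a ≠ b ∧ ¬ G.Adj a b) (hbc : b ≠ c ∧ ¬ G.Adj b c)
    (h1 : ¬ G.SameClass (a, c) (a, b)) (h2 : ¬ G.SameClass (a, c) (b, c))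
    (h : G.SameClass (a, c) (a', c')) :
    G.SameClass (a, b) (a', b) ∧ G.SameClass (b, c) (b, c') := by
  suffices ∀ q, G.SameClass (a, c) q →
      G.SameClass (a, b) (q.1, b) ∧ G.SameClass (b, c) (b, q.2) from this _ h
  intro q hq
  induction hq with
  | refl => exact ⟨.refl _, .refl _⟩
  | @tail p q hp hpq ih =>
    have hab' := ih.1.nonadj hab
    have hbc' := ih.2.nonadj hbc
    have hq : G.SameClass (a, c) q := SameClass.trans hp hpq.sameClass
    cases hpq with
    | @right x y z h3 h4 h5 h6 h7 =>
      dsimp only at *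
      refine ⟨ih.1, ih.2.trans (Forces.sameClass ?_)⟩
      -- If z were b or a neighbour of b, then (x, z) would coincide with (x, b) or force it,
      -- putting (a, c) into the class of (a, b). Hence (b, z) is again a non-adjacent pair and the
      -- forcing carries over from (x, y) to (b, y).
      have hbz : b ≠ z := by
        rintro rfl
        exact h1 (hq.trans ih.1.symm)
      have hnbz : ¬ G.Adj b z := fun hbz' =>
        h1 (SameClass.trans hq ((Forces.right h5 h6 hab'.1 hab'.2 hbz'.symm).sameClass.trans
          ih.1.symm))
      exact .right hbc'.1 hbc'.2 hbz hnbz h7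
    | @left x y z h3 h4 h5 h6 h7 =>
      dsimp only at *
      refine ⟨ih.1.trans (Forces.sameClass ?_), ih.2⟩
      have hbz : b ≠ z := by
        rintro rfl
        exact h2 (hq.trans ih.2.symm)
      have hnbz : ¬ G.Adj b z := fun hbz' =>
        h2 (SameClass.trans hq ((Forces.left h5 h6 hbc'.1.symm (fun h => hbc'.2 h.symm)
          hbz'.symm).sameClass.trans ih.2.symm))
      exact .left hab'.1.symm (fun h => hab'.2 h.symm) hbz hnbz h7

end SimpleGraph

/-! ### The lexicographic transitive orientation -/

/-- The index of an ordered pair of vertices in row-major order. -/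
def pairCode {n : ℕ} (p : Fin n × Fin n) : ℕ := p.1.val * n + p.2.val

theorem pairCode_injective {n : ℕ} : Function.Injective (pairCode (n := n)) := by
  rintro ⟨a, b⟩ ⟨c, d⟩ h
  simp only [pairCode] at h
  have hb := b.2
  have hd := d.2
  have h1 : a.val = c.val := by
    rcases lt_trichotomy a.val c.val with h' | h' | h'
    · nlinarith
    · exact h'
    · nlinarith
  rw [h1] at h
  exact Prod.ext (Fin.ext h1) (Fin.ext (by simpa using h))

/-- `M p` is the least code of a pair in the implication class of `p`. -/
def IsClassMin {n : ℕ} (G : SimpleGraph (Fin n)) (M : Fin n × Fin n → ℕ) : Prop :=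
  ∀ p, (∃ q, G.SameClass p q ∧ M p = pairCode q) ∧ ∀ q, G.SameClass p q → M p ≤ pairCode q

/-- The orientation of the non-adjacent pairs given by least codes. -/
def lexOrient {n : ℕ} (G : SimpleGraph (Fin n)) (M : Fin n × Fin n → ℕ) (a b : Fin n) : Prop :=
  a ≠ b ∧ ¬ G.Adj a b ∧ M (a, b) < M (b, a)

namespace IsClassMin

open SimpleGraph

variable {n : ℕ} {G : SimpleGraph (Fin n)} {M : Fin n × Fin n → ℕ}

theorem eq_of_sameClass (hM : IsClassMin G M) {p q : Fin n × Fin n} (h : G.SameClass p q) :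
    M p = M q := by
  obtain ⟨⟨p', hp', hp⟩, hp''⟩ := hM p
  obtain ⟨⟨q', hq', hq⟩, hq''⟩ := hM q
  have h1 := hp'' q' (h.trans hq')
  have h2 := hq'' p' (h.symm.trans hp')
  omega

theorem sameClass_of_eq (hM : IsClassMin G M) {p q : Fin n × Fin n} (h : M p = M q) :
    G.SameClass p q := by
  obtain ⟨⟨p', hp', hp⟩, -⟩ := hM p
  obtain ⟨⟨q', hq', hq⟩, -⟩ := hM q
  have : p' = q' := pairCode_injective (by omega)
  subst this
  exact hp'.trans hq'.symm

theorem lexOrient_of_sameClass (hM : IsClassMin G M) {a b c d : Fin n}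
    (h : G.SameClass (a, b) (c, d)) (hab : lexOrient G M a b) : lexOrient G M c d := by
  have h1 := h.nonadj ⟨hab.1, hab.2.1⟩
  refine ⟨h1.1, h1.2, ?_⟩
  have h2 : M (b, a) = M (d, c) := hM.eq_of_sameClass h.swap
  rw [← hM.eq_of_sameClass h, ← h2]
  exact hab.2.2

theorem lexOrient_asymm {a b : Fin n} (hab : lexOrient G M a b) : ¬ lexOrient G M b a :=
  fun h => lt_asymm hab.2.2 h.2.2

/-- In a cyclic triangle, (a, c) is the reverse of a chosen pair, so its class contains neither of
the chosen pairs (a, b) and (b, c). This is what the triangle lemma requires. -/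
theorem lexOrient_triangle (hM : IsClassMin G M) {a b c a' c' : Fin n}
    (hab : lexOrient G M a b) (hbc : lexOrient G M b c) (hca : lexOrient G M c a)
    (h : G.SameClass (c, a) (c', a')) :
    G.SameClass (a, b) (a', b) ∧ G.SameClass (b, c) (b, c') := by
  refine SameClass.triangle ⟨hab.1, hab.2.1⟩ ⟨hbc.1, hbc.2.1⟩ ?_ ?_ h.swap
  · intro h1
    exact lexOrient_asymm hca (hM.lexOrient_of_sameClass h1.symm hab)
  · intro h1
    exact lexOrient_asymm hca (hM.lexOrient_of_sameClass h1.symm hbc)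

/-- Move (c, a) to the least pair (c', a') of its class; by the triangle lemma, a', b, c' is again a
cyclic triangle. The least pair of the class of (b, c') must then begin with c', and a second use of
the triangle lemma on that pair reverses the orientation of (c', a'). -/
theorem not_cyclic_of_min (hM : IsClassMin G M) {a b c : Fin n}
    (hab : lexOrient G M a b) (hbc : lexOrient G M b c) (hca : lexOrient G M c a)
    (hmin : M (c, a) ≤ M (b, c)) : False := by
  obtain ⟨⟨⟨c', a'⟩, hcl, hcode⟩, -⟩ := hM (c, a)
  obtain ⟨h1, h2⟩ := hM.lexOrient_triangle hab hbc hca hcl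
  have hca' := hM.lexOrient_of_sameClass hcl hca
  have hab' := hM.lexOrient_of_sameClass h1 hab
  have hbc' := hM.lexOrient_of_sameClass h2 hbc
  obtain ⟨⟨⟨p, q⟩, hpq, hpcode⟩, -⟩ := hM (b, c')
  have h3 : M (c', b) ≤ pairCode (c', b) := (hM (c', b)).2 _ (.refl _)
  have h4 : M (b, c) = M (b, c') := hM.eq_of_sameClass h2
  have h5 := hbc'.2.2
  -- The code of (p, q) is at least that of (c', a') by minimality and less than that of (c', b)
  -- because b is oriented towards c'. Both bounds lie in row c'.
  have hp : p = c' := by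
    simp only [pairCode] at hpcode hcode h3
    have hq := q.2
    have hb := b.2
    have ha' := a'.2
    refine Fin.ext ?_
    rcases lt_trichotomy p.val c'.val with h' | h' | h'
    · nlinarith
    · exact h'
    · nlinarith
  subst hp
  obtain ⟨-, h6⟩ := hM.lexOrient_triangle hca' hab' hbc' hpq
  exact lexOrient_asymm hca' (hM.lexOrient_of_sameClass h6 hab')

theorem not_cyclic (hM : IsClassMin G M) {a b c : Fin n}
    (hab : lexOrient G M a b) (hbc : lexOrient G M b c) (hca : lexOrient G M c a) : False := by
  by_cases h1 : M (c, a) ≤ M (b, c)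
  · exact hM.not_cyclic_of_min hab hbc hca h1
  by_cases h2 : M (b, c) ≤ M (a, b)
  · exact hM.not_cyclic_of_min hca hab hbc h2
  · exact hM.not_cyclic_of_min hbc hca hab (by omega)

/-- Forcing preserves the left-of relation of an interval model, which is asymmetric. So a pair and
its reversal lie in different classes and have different least codes. -/
theorem lexOrient_total (hM : IsClassMin G M) (hG : G.IsMixedUnitInterval) {a b : Fin n}
    (hab : a ≠ b) (hnadj : ¬ G.Adj a b) : lexOrient G M a b ∨ lexOrient G M b a := by
  obtain ⟨L, hasymm, htot, hr, hl, -⟩ := hG.exists_left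
  have key : ∀ p q, G.SameClass p q → L p.1 p.2 → L q.1 q.2 := by
    intro p q h hp
    induction h with
    | refl => exact hp
    | tail _ h ih =>
      cases h with
      | right h1 h2 h3 h4 h5 => exact hr _ _ _ ih h3 h4 h5
      | left h1 h2 h3 h4 h5 => exact hl _ _ _ ih h3 h4 h5
  rcases lt_trichotomy (M (a, b)) (M (b, a)) with h | h | h
  · exact Or.inl ⟨hab, hnadj, h⟩
  · have h1 := hM.sameClass_of_eq h
    rcases htot a b hab hnadj with h2 | h2
    · exact absurd (key _ _ h1 h2) (hasymm _ _ h2)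
    · exact absurd (key _ _ h1.symm h2) (hasymm _ _ h2)
  · exact Or.inr ⟨hab.symm, fun h' => hnadj h'.symm, h⟩

theorem lexOrient_trans (hM : IsClassMin G M) (hG : G.IsMixedUnitInterval) {a b c : Fin n}
    (hab : lexOrient G M a b) (hbc : lexOrient G M b c) : lexOrient G M a c := by
  by_cases hac : a = c
  · subst hac
    exact absurd hbc (lexOrient_asymm hab)
  by_cases hadj : G.Adj a c
  -- If a and c were adjacent, (b, c) would force (b, a).
  · refine absurd (hM.lexOrient_of_sameClass (Forces.sameClass ?_) hbc) (lexOrient_asymm hab)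
    exact .right hbc.1 hbc.2.1 hab.1.symm (fun h => hab.2.1 h.symm) hadj.symm
  · exact (hM.lexOrient_total hG hac hadj).resolve_right (hM.not_cyclic hab hbc)

open Classical in
/-- Predecessor sets form a chain, so comparing their sizes yields an interval ordering. -/
theorem adj_of_card_le (hM : IsClassMin G M) (hG : G.IsMixedUnitInterval) {P : Fin n → ℕ}
    (hP : ∀ v, P v = (Finset.univ.filter fun u => lexOrient G M u v).card) {a b c : Fin n}
    (hab : P a ≤ P b) (hbc : P b ≤ P c) (hne : a ≠ b) (hadj : G.Adj a c) : G.Adj a b := by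
  by_contra hnab
  rw [hP, hP] at hab hbc
  have hba : ¬ lexOrient G M b a := by
    intro hba
    refine absurd hab (not_le.2 (Finset.card_lt_card ((Finset.ssubset_iff_of_subset ?_).2
      ⟨b, by simpa using hba, by simpa using fun h => h.1 rfl⟩)))
    intro x hx
    rw [Finset.mem_filter] at hx ⊢
    exact ⟨hx.1, hM.lexOrient_trans hG hx.2 hba⟩
  have hab' := (hM.lexOrient_total hG hne hnab).resolve_right hba
  have hac : ¬ lexOrient G M a c := fun h => h.2.1 hadj
  -- Otherwise the predecessors of c would all precede b, strictly so because of a, contradicting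
  -- the order of the counts.
  have hex : ∃ y, lexOrient G M y c ∧ ¬ lexOrient G M y b := by
    by_contra! hcon
    refine absurd hbc (not_le.2 (Finset.card_lt_card ((Finset.ssubset_iff_of_subset ?_).2
      ⟨a, by simpa using hab', by simpa using hac⟩)))
    intro x hx
    rw [Finset.mem_filter] at hx ⊢
    exact ⟨hx.1, hcon x hx.2⟩
  obtain ⟨y, hyc, hyb⟩ := hex
  -- The two chosen pairs (a, b) and (y, c) have no orientation across them, so y, b, c, a would be
  -- an induced four-cycle.
  obtain ⟨L, -, -, -, -, hC4⟩ := hG.exists_left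
  have hnadj : ∀ u v, u ≠ v → ¬ lexOrient G M u v → ¬ lexOrient G M v u → G.Adj u v := by
    intro u v huv h1 h2
    by_contra h
    exact (hM.lexOrient_total hG huv h).elim h1 h2
  have hay : G.Adj a y := by
    refine hnadj a y ?_ ?_ ?_
    · rintro rfl; exact hac hyc
    · exact fun h => hac (hM.lexOrient_trans hG h hyc)
    · exact fun h => hyb (hM.lexOrient_trans hG h hab')
  have hyb' : G.Adj y b := by
    refine hnadj y b ?_ hyb ?_
    · rintro rfl; exact hnab hay
    · exact fun h => hac (hM.lexOrient_trans hG hab' (hM.lexOrient_trans hG h hyc))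
  have hbc' : G.Adj b c := by
    refine hnadj b c ?_ ?_ ?_
    · rintro rfl; exact hyb hyc
    · exact fun h => hac (hM.lexOrient_trans hG hab' h)
    · exact fun h => hyb (hM.lexOrient_trans hG hyc h)
  exact hnab (hC4 y b c a hyb' hbc' hadj.symm hay hyc.1 hyc.2.1 hne)

end IsClassMin

/-! ### First-fit colouring along an interval ordering -/

/-- `R` is the rank function of an ordering by left ends of an interval model of `G`. -/
structure IsIntervalRank {n : ℕ} (G : SimpleGraph (Fin n)) (R : Fin n → ℕ) : Prop where
  inj : Function.Injective R
  adj : ∀ {a b c}, R a < R b → R b < R c → G.Adj a c → G.Adj a b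

/-- `c` is the first-fit colouring along `R`, where twins do not obstruct each other. -/
def IsFirstFit {n : ℕ} (G : SimpleGraph (Fin n)) (R c : Fin n → ℕ) : Prop :=
  ∀ v, (∀ w, R w < R v → G.Adj w v → ¬ G.IsTwin w v → c w ≠ c v) ∧
    ∀ y < c v, ∃ w, R w < R v ∧ G.Adj w v ∧ ¬ G.IsTwin w v ∧ c w = y

section colouring

variable {n : ℕ} {G : SimpleGraph (Fin n)} {R c : Fin n → ℕ}

/-- The earlier of a and b reaches u, hence also the vertex in between. So earlier neighbours of a
vertex form a clique. -/
theorem IsIntervalRank.adj_of_adj (hR : IsIntervalRank G R) {a b u : Fin n} (ha : R a < R u)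
    (hb : R b < R u) (hau : G.Adj a u) (hbu : G.Adj b u) (hab : a ≠ b) : G.Adj a b := by
  rcases lt_trichotomy (R a) (R b) with h | h | h
  · exact hR.adj h hb hau
  · exact absurd (hR.inj h) hab
  · exact (hR.adj h ha hbu).symm

/-- If the colours differed, the smaller one would be blocked at the other twin by a non-twin
neighbour w. Since w sees both twins, it has a forbidden conflict with the twin of that colour,
whichever of the two comes later. -/
theorem IsFirstFit.eq_of_isTwin_of_lt (hc : IsFirstFit G R c) (hR : IsIntervalRank G R)
    {u v : Fin n} (h : G.IsTwin u v) (huv : R u < R v) : c u = c v := by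
  rcases lt_trichotomy (c u) (c v) with h' | h' | h'
  · obtain ⟨w, hwv, hadj, hnt, hcw⟩ := (hc v).2 _ h'
    have hwu : w ≠ u := by
      rintro rfl
      exact hnt h
    have hntu : ¬ G.IsTwin w u := fun h1 => hnt (h1.trans h)
    have hadju : G.Adj w u := ((h.adj_iff hwu hadj.ne).2 hadj.symm).symm
    rcases lt_trichotomy (R w) (R u) with h1 | h1 | h1
    · exact absurd hcw ((hc u).1 w h1 hadju hntu)
    · exact absurd (hR.inj h1) hwu
    · exact absurd hcw.symm ((hc w).1 u h1 hadju.symm fun h2 => hntu h2.symm)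
  · exact h'
  · obtain ⟨w, hwu, hadj, hnt, hcw⟩ := (hc u).2 _ h'
    have hwv : w ≠ v := by
      rintro rfl
      exact hnt h.symm
    exact absurd hcw ((hc v).1 w (hwu.trans huv)
      ((h.adj_iff hadj.ne hwv).1 hadj.symm).symm fun h1 => hnt (h1.trans h.symm))

theorem IsFirstFit.eq_of_isTwin (hc : IsFirstFit G R c) (hR : IsIntervalRank G R)
    {u v : Fin n} (h : G.IsTwin u v) : c u = c v := by
  rcases lt_trichotomy (R u) (R v) with h' | h' | h'
  · exact hc.eq_of_isTwin_of_lt hR h h'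
  · rw [hR.inj h']
  · exact (hc.eq_of_isTwin_of_lt hR h.symm h').symm

theorem IsFirstFit.isTwin_of_eq (hc : IsFirstFit G R c) (hR : IsIntervalRank G R)
    {u v : Fin n} (hadj : u ≠ v → G.Adj u v) (h : c u = c v) : G.IsTwin u v := by
  by_contra hnt
  have hne : u ≠ v := by
    rintro rfl
    exact hnt (.refl u)
  rcases lt_trichotomy (R u) (R v) with h' | h' | h'
  · exact (hc v).1 u h' (hadj hne) hnt h
  · exact hne (hR.inj h')
  · exact (hc u).1 v h' (hadj hne).symm (fun h1 => hnt h1.symm) h.symm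

/-- All colours from 0 to `c v` occur on the clique formed by v and its earlier neighbours, and the
colour is a function of the bubble. So this clique meets at least `c v + 1` bubbles. -/
theorem IsFirstFit.lt_two_mul_bubbleP (hc : IsFirstFit G R c) (hR : IsIntervalRank G R)
    (hG : G.IsMixedUnitInterval) (v : Fin n) : c v < 2 * G.bubbleP := by
  set K : Set (Fin n) := {w | w = v ∨ (R w < R v ∧ G.Adj w v)}
  have hK : G.IsClique K := by
    rintro a (rfl | ⟨ha, ha'⟩) b (rfl | ⟨hb, hb'⟩) hab
    · exact absurd rfl hab
    · exact hb'.symm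
    · exact ha'
    · exact hR.adj_of_adj ha hb ha' hb' hab
  have h1 : (↑(Finset.range (c v + 1)) : Set ℕ) ⊆ c '' K := by
    intro y hy
    rw [Finset.coe_range, Set.mem_Iio] at hy
    rcases (Nat.lt_succ_iff.1 hy).lt_or_eq with h | h
    · obtain ⟨w, hw, hw', -, rfl⟩ := (hc v).2 y h
      exact ⟨w, Or.inr ⟨hw, hw'⟩, rfl⟩
    · exact ⟨v, Or.inl rfl, h.symm⟩
  have hex : ∀ s ∈ G.bubble '' K, ∃ w ∈ K, G.bubble w = s := fun s hs => hs
  have : Nonempty (Fin n) := ⟨v⟩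
  choose! f hf using hex
  have h2 : c '' K ⊆ (fun s => c (f s)) '' (G.bubble '' K) := by
    rintro _ ⟨w, hw, rfl⟩
    exact ⟨_, ⟨w, hw, rfl⟩, hc.eq_of_isTwin hR
      (SimpleGraph.bubble_eq_iff.1 (hf _ ⟨w, hw, rfl⟩).2)⟩
  have h3 := Set.ncard_le_ncard (h1.trans h2) (Set.toFinite _)
  rw [Set.ncard_coe_finset, Finset.card_range] at h3
  have h4 := h3.trans (Set.ncard_image_le (Set.toFinite _))
  exact h4.trans (hG.bubbleCount_le hK)

end colouring

/-! ### Building the expression along the ordering -/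

namespace CliqueExpr

variable {n : ℕ} (G : SimpleGraph (Fin n)) (R c : Fin n → ℕ) (m : ℕ)

theorem self_mem_nodes {V : Type*} (t : CliqueExpr V) : t ∈ t.nodes := by
  cases t <;> simp [nodes]

/-- Label `0` is arbitrary; the other labels are determined by the colour and live on a clique. -/
def NodeOK (t : CliqueExpr (Fin n)) : Prop :=
  (∀ v ∈ t.verts, t.label v ≠ 0 → t.label v = c v + 1) ∧
    ∀ v ∈ t.verts, ∀ w ∈ t.verts, t.label v ≠ 0 → t.label w ≠ 0 → v ≠ w → G.Adj v w

/-- The conditions maintained by all expressions built along an interval ordering. -/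
structure Tame (T : CliqueExpr (Fin n)) : Prop where
  wf : T.WellFormed
  le : T.graph ≤ G
  node : ∀ t ∈ T.nodes, NodeOK G c t
  labels : T.labels ⊆ Finset.range m

/-- `T` is an expression for the vertices up to `p`; only the neighbours of `p` and `p` itself have
non-zero labels. -/
structure Built (p : Fin n) (T : CliqueExpr (Fin n)) : Prop where
  tame : Tame G c m T
  verts : T.verts = {v | R v ≤ R p}
  edges : ∀ a b, R a ≤ R p → R b ≤ R p → G.Adj a b → T.graph.Adj a b
  alive : ∀ y, R y ≤ R p → (y = p ∨ G.Adj y p) → T.label y = c y + 1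
  dead : ∀ y, R y ≤ R p → ¬ (y = p ∨ G.Adj y p) → T.label y = 0

/-- The intermediate stage in which the non-neighbours of the next vertex `u` that have an index
less than `x` have received label `0`. -/
structure Relabelled (p u : Fin n) (x : ℕ) (T : CliqueExpr (Fin n)) : Prop where
  tame : Tame G c m T
  verts : T.verts = {v | R v ≤ R p}
  edges : ∀ a b, R a ≤ R p → R b ≤ R p → G.Adj a b → T.graph.Adj a b
  alive : ∀ y, R y ≤ R p → G.Adj y u → T.label y = c y + 1
  near : ∀ y, R y ≤ R p → T.label y ≠ 0 → y = p ∨ G.Adj y p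
  dead : ∀ y, R y ≤ R p → y.val < x → ¬ G.Adj y u → T.label y = 0

/-- The intermediate stage in which the new vertex `u` has been connected to its neighbours with
index less than `x`. -/
structure Joined (u : Fin n) (x : ℕ) (T : CliqueExpr (Fin n)) : Prop where
  tame : Tame G c m T
  verts : T.verts = {v | R v ≤ R u}
  edges : ∀ a b, R a < R u → R b < R u → G.Adj a b → T.graph.Adj a b
  new : ∀ w, w.val < x → R w < R u → G.Adj w u → T.graph.Adj w u
  alive : ∀ y, R y ≤ R u → (y = u ∨ G.Adj y u) → T.label y = c y + 1
  dead : ∀ y, R y ≤ R u → ¬ (y = u ∨ G.Adj y u) → T.label y = 0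

variable {G R c m}

/-- Relabelling to 0 only shrinks the set of vertices with nonzero label. -/
theorem Tame.relabel {T : CliqueExpr (Fin n)} (h : Tame G c m T) {i : ℕ} (hi : i < m) :
    Tame G c m (relabel i 0 T) where
  wf := h.wf
  le := h.le
  node := by
    intro t ht
    rw [nodes, List.mem_cons] at ht
    rcases ht with rfl | ht
    · obtain ⟨h1, h2⟩ := h.node T T.self_mem_nodes
      constructor
      · intro v hv hl
        simp only [label] at hl ⊢
        split_ifs at hl ⊢
        · exact absurd rfl hl
        · exact h1 v hv hl
      · intro v hv w hw hlv hlw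
        simp only [label] at hlv hlw
        split_ifs at hlv hlw
        all_goals first | exact absurd rfl hlv | exact absurd rfl hlw | exact h2 v hv w hw hlv hlw
    · exact h.node t ht
  labels := by
    intro l hl
    simp only [CliqueExpr.labels, Finset.mem_union, Finset.mem_insert, Finset.mem_singleton] at hl
    rcases hl with (rfl | rfl) | hl
    · exact Finset.mem_range.2 hi
    · exact Finset.mem_range.2 (by omega)
    · exact h.labels hl

/-- The vertices with nonzero label form a clique of G, so a join of nonzero labels can only create
edges of G. -/
theorem Tame.join {T : CliqueExpr (Fin n)} (h : Tame G c m T) {i j : ℕ} (hi : i + 1 < m)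
    (hj : j + 1 < m) : Tame G c m (join (i + 1) (j + 1) T) where
  wf := h.wf
  le := by
    refine sup_le h.le ?_
    obtain ⟨-, h2⟩ := h.node T T.self_mem_nodes
    intro x y hxy
    rw [SimpleGraph.fromRel_adj] at hxy
    obtain ⟨hne, ⟨hx, hy⟩ | ⟨hy, hx⟩⟩ := hxy
    · exact h2 x hx.1 y hy.1 (by rw [hx.2]; omega) (by rw [hy.2]; omega) hne
    · exact h2 x hx.1 y hy.1 (by rw [hx.2]; omega) (by rw [hy.2]; omega) hne
  node := by
    intro t ht
    rw [nodes, List.mem_cons] at ht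
    rcases ht with rfl | ht
    · exact h.node T T.self_mem_nodes
    · exact h.node t ht
  labels := by
    intro l hl
    simp only [CliqueExpr.labels, Finset.mem_union, Finset.mem_insert, Finset.mem_singleton] at hl
    rcases hl with (rfl | rfl) | hl
    · exact Finset.mem_range.2 hi
    · exact Finset.mem_range.2 hj
    · exact h.labels hl

theorem Tame.vertex {v : Fin n} (hv : c v + 1 < m) : Tame G c m (vertex (c v + 1) v) where
  wf := trivial
  le := bot_le
  node := by
    intro t ht
    rw [nodes, List.mem_singleton] at ht
    subst ht
    constructor
    · rintro w rfl -
      rfl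
    · rintro w rfl w' rfl - - h
      exact absurd rfl h
  labels := by simpa [CliqueExpr.labels] using hv

theorem built_vertex {p : Fin n} (hR : IsIntervalRank G R) (hp : R p = 0) (hm : c p + 1 < m) :
    Built G R c m p (vertex (c p + 1) p) := by
  have key : ∀ y, R y ≤ R p → y = p := fun y hy => hR.inj (by omega)
  refine ⟨.vertex hm, ?_, ?_, ?_, ?_⟩
  · ext y
    exact ⟨fun h => by rw [show y = p from h]; exact le_rfl (a := R p), fun h => key y h⟩
  · intro a b ha hb hab
    rw [key a ha, key b hb] at hab
    exact absurd hab G.irrefl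
  · intro y hy _
    rw [key y hy]
    rfl
  · intro y hy h
    exact absurd (Or.inl (key y hy)) h

/-- As p immediately precedes u, every earlier neighbour of u is p itself or a neighbour of p, and
therefore still carries its colour label. -/
theorem Built.relabelled {p u : Fin n} {T : CliqueExpr (Fin n)} (h : Built G R c m p T)
    (hR : IsIntervalRank G R) (hu : R u = R p + 1) : Relabelled G R c m p u 0 T where
  tame := h.tame
  verts := h.verts
  edges := h.edges
  alive y hy hyu := by
    refine h.alive y hy ?_
    by_cases hyp : y = p
    · exact Or.inl hyp
    · have : R y ≠ R p := fun h => hyp (hR.inj h)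
      exact Or.inr (hR.adj (by omega) (by omega) hyu)
  near y hy hl := by
    by_contra hcon
    exact hl (h.dead y hy hcon)
  dead y _ hy := absurd hy (by omega)

theorem Relabelled.skip {p u w : Fin n} {T : CliqueExpr (Fin n)}
    (h : Relabelled G R c m p u w T)
    (hw : ¬ (R w ≤ R p ∧ (w = p ∨ G.Adj w p) ∧ ¬ G.Adj w u)) :
    Relabelled G R c m p u (w + 1) T where
  tame := h.tame
  verts := h.verts
  edges := h.edges
  alive := h.alive
  near := h.near
  dead y hy hyw hyu := by
    rcases (Nat.lt_succ_iff.1 hyw).lt_or_eq with h1 | h1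
    · exact h.dead y hy h1 hyu
    · obtain rfl := Fin.ext h1
      by_contra hl
      exact hw ⟨hy, h.near y hy hl, hyu⟩

/-- The operation retires every vertex that carries the label of w, so it must not hit a neighbour y
of u. Such a y would lie with w in the closed neighbourhood of p, a clique among the vertices up to
p, and share its colour. Then y and w would be twins, although u is adjacent to y only. -/
theorem Relabelled.step {p u w : Fin n} {T : CliqueExpr (Fin n)}
    (h : Relabelled G R c m p u w T) (hR : IsIntervalRank G R) (hc : IsFirstFit G R c)
    (hm : ∀ v, c v + 1 < m) (hu : R u = R p + 1)
    (hw : R w ≤ R p) (hwp : w = p ∨ G.Adj w p) (hwu : ¬ G.Adj w u) :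
    Relabelled G R c m p u (w + 1) (relabel (c w + 1) 0 T) where
  tame := h.tame.relabel (hm w)
  verts := h.verts
  edges := h.edges
  alive y hy hyu := by
    have h1 := h.alive y hy hyu
    simp only [label]
    rw [if_neg, h1]
    intro h2
    have hcw : c w = c y := by omega
    have hyp := h.near y hy (by omega)
    have hwy : w ≠ y → G.Adj w y := by
      intro hne
      rcases hwp with rfl | hwp <;> rcases hyp with rfl | hyp
      · exact absurd rfl hne
      · exact hyp.symm
      · exact hwp
      · have h3 : R w ≠ R p := fun h => hwp.ne (hR.inj h)
        have h4 : R y ≠ R p := fun h => hyp.ne (hR.inj h)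
        exact hR.adj_of_adj (by omega) (by omega) hwp hyp hne
    have htw := hc.isTwin_of_eq hR hwy hcw
    refine hwu ((htw.adj_iff (w := u) ?_ hyu.ne').2 hyu)
    rintro rfl
    omega
  near y hy hl := by
    refine h.near y hy ?_
    simp only [label] at hl
    split_ifs at hl
    · exact absurd rfl hl
    · exact hl
  dead y hy hyw hyu := by
    simp only [label]
    split_ifs with hl
    · rfl
    · rcases (Nat.lt_succ_iff.1 hyw).lt_or_eq with h1 | h1
      · exact h.dead y hy h1 hyu
      · obtain rfl := Fin.ext h1
        by_contra h2
        exact hl ((h.tame.node T T.self_mem_nodes).1 y (by rw [h.verts]; exact hy) h2)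

/-- The live vertices are now the earlier neighbours of u, which with u form a clique. The node
condition speaks about G and not about the value of the expression, so it already holds before u is
joined to anything. -/
theorem Relabelled.union {p u : Fin n} {T : CliqueExpr (Fin n)}
    (h : Relabelled G R c m p u n T) (hR : IsIntervalRank G R)
    (hm : ∀ v, c v + 1 < m) (hu : R u = R p + 1) :
    Joined G R c m u 0 (union T (vertex (c u + 1) u)) := by
  have hlt : ∀ y, R y ≤ R u → y ≠ u → R y ≤ R p := by
    intro y hy hne
    have : R y ≠ R u := fun h => hne (hR.inj h)
    omega
  have hmem : ∀ y, y ∈ T.verts ↔ R y ≤ R p := fun y => by rw [h.verts]; rfl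
  have hu' : u ∉ T.verts := by rw [hmem]; omega
  have hverts : (CliqueExpr.union T (CliqueExpr.vertex (c u + 1) u)).verts = {v | R v ≤ R u} := by
    ext y
    simp only [CliqueExpr.verts, Set.mem_union, hmem, Set.mem_singleton_iff, Set.mem_ofPred_eq]
    constructor
    · rintro (h | rfl)
      · omega
      · exact le_rfl
    · intro hy
      by_cases hyu : y = u
      · exact Or.inr hyu
      · exact Or.inl (hlt y hy hyu)
  have hlab_u : (CliqueExpr.union T (CliqueExpr.vertex (c u + 1) u)).label u = c u + 1 := by
    simp [label, hu']
  have hlab : ∀ y, y ≠ u → R y ≤ R u →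
      (CliqueExpr.union T (CliqueExpr.vertex (c u + 1) u)).label y = T.label y := by
    intro y hyu hy
    simp [label, (hmem y).2 (hlt y hy hyu)]
  have halive : ∀ y, R y ≤ R u → (y = u ∨ G.Adj y u) →
      (CliqueExpr.union T (CliqueExpr.vertex (c u + 1) u)).label y = c y + 1 := by
    rintro y hy (rfl | hyu)
    · exact hlab_u
    · rw [hlab y hyu.ne hy]
      exact h.alive y (hlt y hy hyu.ne) hyu
  have hdead : ∀ y, R y ≤ R u → ¬ (y = u ∨ G.Adj y u) →
      (CliqueExpr.union T (CliqueExpr.vertex (c u + 1) u)).label y = 0 := by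
    intro y hy hyu
    rw [hlab y (fun h => hyu (Or.inl h)) hy]
    exact h.dead y (hlt y hy fun h => hyu (Or.inl h)) y.2 fun h => hyu (Or.inr h)
  have hv : Tame G c m (CliqueExpr.vertex (c u + 1) u) := .vertex (hm u)
  refine ⟨⟨⟨?_, h.tame.wf, hv.wf⟩, sup_le h.tame.le hv.le, ?_, ?_⟩, hverts, ?_, ?_, halive, hdead⟩
  · rw [Set.disjoint_left]
    rintro y hy rfl
    exact hu' hy
  · intro t ht
    rw [nodes, List.mem_cons, List.mem_append] at ht
    rcases ht with rfl | ht | ht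
    · have hcl : ∀ y, R y ≤ R u →
          (CliqueExpr.union T (CliqueExpr.vertex (c u + 1) u)).label y ≠ 0 →
          y = u ∨ G.Adj y u := by
        intro y hy hl
        by_contra hcon
        exact hl (hdead y hy hcon)
      rw [NodeOK, hverts]
      refine ⟨fun y hy hl => halive y hy (hcl y hy hl), fun v hv w hw hlv hlw hne => ?_⟩
      rcases hcl v hv hlv with rfl | h1 <;> rcases hcl w hw hlw with rfl | h2
      · exact absurd rfl hne
      · exact h2.symm
      · exact h1
      · have h3 := hlt v hv h1.ne
        have h4 := hlt w hw h2.ne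
        exact hR.adj_of_adj (by omega) (by omega) h1 h2 hne
    · exact h.tame.node t ht
    · exact hv.node t ht
  · exact Finset.union_subset h.tame.labels hv.labels
  · intro a b ha hb hab
    exact Or.inl (h.edges a b (by omega) (by omega) hab)
  · intro w hw
    exact absurd hw (by omega)

theorem Joined.skip {u w : Fin n} {T : CliqueExpr (Fin n)} (h : Joined G R c m u w T)
    (hw : ¬ (R w < R u ∧ G.Adj w u)) : Joined G R c m u (w + 1) T where
  tame := h.tame
  verts := h.verts
  edges := h.edges
  new y hy hyu hadj := by
    rcases (Nat.lt_succ_iff.1 hy).lt_or_eq with h1 | h1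
    · exact h.new y h1 hyu hadj
    · obtain rfl := Fin.ext h1
      exact absurd ⟨hyu, hadj⟩ hw
  alive := h.alive
  dead := h.dead

/-- Both labels are live, so the join produces the edge between w and u and nothing outside G. If
the two colours coincide, the operation is a join of a label with itself. -/
theorem Joined.step {u w : Fin n} {T : CliqueExpr (Fin n)} (h : Joined G R c m u w T)
    (hm : ∀ v, c v + 1 < m) (hw : R w < R u) (hwu : G.Adj w u) :
    Joined G R c m u (w + 1) (join (c u + 1) (c w + 1) T) where
  tame := h.tame.join (hm u) (hm w)
  verts := h.verts
  edges a b ha hb hab := Or.inl (h.edges a b ha hb hab)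
  new y hy hyu hadj := by
    rcases (Nat.lt_succ_iff.1 hy).lt_or_eq with h1 | h1
    · exact Or.inl (h.new y h1 hyu hadj)
    · obtain rfl := Fin.ext h1
      refine Or.inr ((SimpleGraph.fromRel_adj _ _ _).2 ⟨hadj.ne, Or.inr ⟨⟨?_, ?_⟩, ⟨?_, ?_⟩⟩⟩)
      · rw [h.verts]; exact le_rfl (a := R u)
      · exact h.alive u le_rfl (Or.inl rfl)
      · rw [h.verts]; exact hw.le
      · exact h.alive y hw.le (Or.inr hwu)
  alive := h.alive
  dead := h.dead

theorem Joined.built {u : Fin n} {T : CliqueExpr (Fin n)} (h : Joined G R c m u n T)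
    (hR : IsIntervalRank G R) : Built G R c m u T where
  tame := h.tame
  verts := h.verts
  edges a b ha hb hab := by
    rcases ha.lt_or_eq with ha | ha
    · rcases hb.lt_or_eq with hb | hb
      · exact h.edges a b ha hb hab
      · obtain rfl := hR.inj hb
        exact h.new a a.2 ha hab
    · obtain rfl := hR.inj ha
      rcases hb.lt_or_eq with hb | hb
      · exact (h.new b b.2 hb hab.symm).symm
      · exact absurd (hR.inj hb).symm hab.ne
  alive := h.alive
  dead := h.dead

/-- With label 0 set aside, the remaining vertices of a node form a clique labelled by colour, and
equal colours on a clique mean twins. -/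
theorem Built.isABDDecomposition {p : Fin n} {T : CliqueExpr (Fin n)} (h : Built G R c m p T)
    (hR : IsIntervalRank G R) (hc : IsFirstFit G R c) (hp : ∀ v, R v ≤ R p) :
    T.IsABDDecomposition G 1 1 1 := by
  refine ⟨⟨h.tame.wf, ?_, le_antisymm h.tame.le fun a b hab => h.edges a b (hp a) (hp b) hab⟩, ?_⟩
  · rw [h.verts]
    exact Set.eq_univ_of_forall hp
  · intro t ht
    obtain ⟨h1, h2⟩ := h.tame.node t ht
    -- Needed because the exceptional set is cut down to the labels in use: a label outside that set
    -- is known to be nonzero only if it is one of those labels.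
    have hlab : ∀ s : CliqueExpr (Fin n), ∀ t ∈ s.nodes, ∀ v ∈ t.verts, t.label v ∈ s.labels := by
      have hself : ∀ s : CliqueExpr (Fin n), ∀ v ∈ s.verts, s.label v ∈ s.labels := by
        intro s
        induction s with
        | vertex l w => intro v _; simp [label, CliqueExpr.labels]
        | union a b iha ihb =>
          intro v hv
          simp only [label, CliqueExpr.labels, Finset.mem_union]
          split_ifs with hva
          · exact Or.inl (iha v hva)
          · exact Or.inr (ihb v (hv.resolve_left hva))
        | join i j e ih =>
          intro v hv
          exact Finset.mem_union_right _ (ih v hv)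
        | relabel i j e ih =>
          intro v hv
          simp only [label, CliqueExpr.labels]
          split_ifs
          · simp
          · exact Finset.mem_union_right _ (ih v hv)
      intro s
      induction s with
      | vertex l w =>
        intro t ht
        rw [nodes, List.mem_singleton] at ht
        exact ht ▸ hself _
      | union a b iha ihb =>
        intro t ht v hv
        rw [nodes, List.mem_cons, List.mem_append] at ht
        rcases ht with rfl | ht | ht
        · exact hself _ v hv
        · exact Finset.mem_union_left _ (iha t ht v hv)
        · exact Finset.mem_union_right _ (ihb t ht v hv)
      | join i j e ih =>
        intro t ht v hv
        rw [nodes, List.mem_cons] at ht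
        rcases ht with rfl | ht
        · exact hself _ v hv
        · exact Finset.mem_union_right _ (ih t ht v hv)
      | relabel i j e ih =>
        intro t ht v hv
        rw [nodes, List.mem_cons] at ht
        rcases ht with rfl | ht
        · exact hself _ v hv
        · exact Finset.mem_union_right _ (ih t ht v hv)
    have hL : ∀ l ∈ T.labels, l ∉ T.labels ∩ {0} → l ≠ 0 := by
      rintro _ hl hl' rfl
      exact hl' (by simpa using hl)
    -- The intersection covers the case in which label 0 never occurs.
    refine ⟨T.labels ∩ {0}, Finset.inter_subset_left,
      (Finset.card_le_card Finset.inter_subset_right).trans (Finset.card_singleton 0).le, ?_, ?_⟩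
    · refine SimpleGraph.indepNum_induce_le_one ?_
      rintro v ⟨hv, hlv⟩ w ⟨hw, hlw⟩ hne
      exact h2 v hv w hw (hL _ (hlab T t ht v hv) hlv) (hL _ (hlab T t ht w hw) hlw) hne
    · intro l hl hl'
      refine SimpleGraph.bubbleCount_le_one ?_
      rintro v ⟨hv, rfl⟩ w ⟨hw, hlw⟩
      have hv0 := hL _ hl hl'
      have hw0 : t.label w ≠ 0 := by rwa [hlw]
      refine hc.isTwin_of_eq hR (h2 v hv w hw hv0 hw0) ?_
      have e1 := h1 v hv hv0
      have e2 := h1 w hw hw0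
      omega

theorem Tame.width_le {T : CliqueExpr (Fin n)} (h : Tame G c m T) : T.width ≤ m :=
  (Finset.card_le_card h.labels).trans (Finset.card_range m).le

end CliqueExpr

/-! ### A language of bounded loops and its semantics -/

/-- Arithmetic expressions over the variables and arrays of a store. The semantics refers to a
size parameter `n`, which is also the length of all sums and loops. -/
inductive Exp where
  | var (x : ℕ)
  | lit (c : ℕ)
  | size
  | add (a b : Exp)
  | sub (a b : Exp)
  | get (A : ℕ) (e : Exp)
  | sum (i : ℕ) (e : Exp)

/-- Loop programs: all loops run from `0` to `n - 1`. -/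
inductive Cmd where
  | assign (x : ℕ) (e : Exp)
  | write (A : ℕ) (i e : Exp)
  | seq (p q : Cmd)
  | ite (e : Exp) (p q : Cmd)
  | skip
  | loop (i : ℕ) (p : Cmd)

open Ram (State)

/-- Iteration of a step function that also receives the index of the step. -/
def iterate {α : Type*} (f : ℕ → α → α) : ℕ → α → α
  | 0, s => s
  | k + 1, s => f k (iterate f k s)

/-- The value of an expression. -/
def Exp.eval (n : ℕ) : Exp → State → ℕ
  | var x, s => s.reg x
  | lit c, _ => c
  | size, _ => n
  | add a b, s => a.eval n s + b.eval n s
  | sub a b, s => a.eval n s - b.eval n s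
  | get A e, s => s.arr A (e.eval n s)
  | sum i e, s => ∑ x ∈ Finset.range n, e.eval n (s.setReg i x)

/-- The effect of a loop program. -/
def Cmd.run (n : ℕ) : Cmd → State → State
  | assign x e, s => s.setReg x (e.eval n s)
  | write A i e, s => s.setArr A (i.eval n s) (e.eval n s)
  | seq p q, s => q.run n (p.run n s)
  | ite e p q, s => if e.eval n s ≠ 0 then p.run n s else q.run n s
  | skip, s => s
  | loop i p, s => iterate (fun x s => p.run n (s.setReg i x)) n s

/-! ### Representing stores in the machine -/

namespace Ram

/-- The register that holds a variable of a loop program. -/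
def varReg (x : ℕ) : ℕ := 2 * x + 2

/-- The `k`-th auxiliary register. -/
def auxReg (k : ℕ) : ℕ := 2 * k + 1

/-- `r := a`, using the scratch register `z`. -/
def move (r a z : ℕ) : Ram := .seq (.const z 0) (.plus r a z)

/-- The state `s` represents the store `σ`, and register `0` contains `n`. -/
def Represents (n : ℕ) (σ s : State) : Prop :=
  s.reg 0 = n ∧ (∀ x, s.reg (varReg x) = σ.reg x) ∧ s.arr = σ.arr

/-- The auxiliary registers below `k` agree. -/
def AuxAgree (k : ℕ) (s s' : State) : Prop := ∀ j < k, s'.reg (auxReg j) = s.reg (auxReg j)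

@[simp] theorem State.setReg_reg (s : State) (r x r' : ℕ) :
    (s.setReg r x).reg r' = if r' = r then x else s.reg r' := by
  simp [State.setReg, Function.update_apply]

@[simp] theorem State.setReg_arr (s : State) (r x : ℕ) : (s.setReg r x).arr = s.arr := rfl

@[simp] theorem State.setArr_reg (s : State) (A k x : ℕ) : (s.setArr A k x).reg = s.reg := rfl

@[simp] theorem State.setArr_arr (s : State) (A k x B l : ℕ) :
    (s.setArr A k x).arr B l = if B = A ∧ l = k then x else s.arr B l := by
  simp only [State.setArr, Function.update_apply]
  by_cases h : B = A
  · subst h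
    simp [Function.update_apply]
  · simp [h]

theorem State.ext' {s s' : State} (h : ∀ r, s.reg r = s'.reg r) (h' : s.arr = s'.arr) :
    s = s' := by
  cases s
  cases s'
  simp only [State.mk.injEq]
  exact ⟨funext h, h'⟩

@[simp] theorem varReg_inj {x y : ℕ} : varReg x = varReg y ↔ x = y := by
  simp only [varReg]; omega

@[simp] theorem auxReg_inj {x y : ℕ} : auxReg x = auxReg y ↔ x = y := by
  simp only [auxReg]; omega

@[simp] theorem varReg_ne_auxReg {x y : ℕ} : varReg x ≠ auxReg y := by
  simp only [auxReg, varReg]; omega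

@[simp] theorem auxReg_ne_varReg {x y : ℕ} : auxReg x ≠ varReg y := by
  simp only [auxReg, varReg]; omega

@[simp] theorem varReg_ne_zero {x : ℕ} : varReg x ≠ 0 := by
  simp only [varReg]; omega

@[simp] theorem zero_ne_varReg {x : ℕ} : 0 ≠ varReg x := by
  simp only [varReg]; omega

@[simp] theorem zero_ne_auxReg {x : ℕ} : 0 ≠ auxReg x := by
  simp only [auxReg]; omega

theorem AuxAgree.refl (k : ℕ) (s : State) : AuxAgree k s s := fun _ _ => rfl

theorem AuxAgree.trans {k : ℕ} {s s' s'' : State} (h : AuxAgree k s s') (h' : AuxAgree k s' s'') :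
    AuxAgree k s s'' := fun j hj => (h' j hj).trans (h j hj)

theorem AuxAgree.mono {k l : ℕ} {s s' : State} (h : AuxAgree k s s') (hl : l ≤ k) :
    AuxAgree l s s' := fun j hj => h j (by omega)

theorem AuxAgree.setAux {k l x : ℕ} {s s' : State} (h : AuxAgree k s s') (hl : k ≤ l) :
    AuxAgree k s (s'.setReg (auxReg l) x) := fun j hj => by
  rw [State.setReg_reg, if_neg (by simp only [auxReg_inj]; omega)]
  exact h j hj

theorem AuxAgree.setVar {k l x : ℕ} {s s' : State} (h : AuxAgree k s s') :
    AuxAgree k s (s'.setReg (varReg l) x) := fun j hj => by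
  rw [State.setReg_reg, if_neg (by simp)]
  exact h j hj

theorem Represents.setAux {n k x : ℕ} {σ s : State} (h : Represents n σ s) :
    Represents n σ (s.setReg (auxReg k) x) := by
  refine ⟨by simpa using h.1, fun y => by simpa using h.2.1 y, h.2.2⟩

theorem Represents.setVar {n v x : ℕ} {σ s : State} (h : Represents n σ s) :
    Represents n (σ.setReg v x) (s.setReg (varReg v) x) := by
  refine ⟨by simpa using h.1, fun y => ?_, h.2.2⟩
  simp [h.2.1 y]

theorem Represents.setArr {n A k x : ℕ} {σ s : State} (h : Represents n σ s) :
    Represents n (σ.setArr A k x) (s.setArr A k x) := by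
  refine ⟨h.1, h.2.1, ?_⟩
  simp [State.setArr, h.2.2]

theorem exec_move (r a z : ℕ) (s : State) (h : a ≠ z) :
    Exec (move r a z) s ((s.setReg z 0).setReg r (s.reg a)) 2 := by
  have := Exec.seq (Exec.const z 0 s) (Exec.plus r a z _)
  simpa [h, move] using this

end Ram

/-! ### Compilation with polynomial time bounds -/

open Ram

/-- Code that leaves the value of the expression in the auxiliary register `k`; it uses no
auxiliary register below `k` and restores all variables. -/
def Exp.compile : Exp → ℕ → Ram
  | var x, k => move (auxReg k) (varReg x) (auxReg (k + 1))
  | lit c, k => .const (auxReg k) c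
  | size, k => move (auxReg k) 0 (auxReg (k + 1))
  | add a b, k => .seq (a.compile k) (.seq (b.compile (k + 1))
      (.plus (auxReg k) (auxReg k) (auxReg (k + 1))))
  | sub a b, k => .seq (a.compile k) (.seq (b.compile (k + 1))
      (.minus (auxReg k) (auxReg k) (auxReg (k + 1))))
  | get A e, k => .seq (e.compile k) (.load (auxReg k) A (auxReg k))
  | sum i e, k =>
      -- The outer value of the bound variable is saved in register k + 1. The scratch register of
      -- this move is register k, which is thereby set to 0 and can serve as the accumulator.
      -- Register k + 2 holds the number of remaining rounds.
      .seq (move (auxReg (k + 1)) (varReg i) (auxReg k)) <|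
      .seq (.const (varReg i) 0) <|
      .seq (.minus (auxReg (k + 2)) 0 (varReg i)) <|
      .seq (.loop (auxReg (k + 2)) <|
        .seq (e.compile (k + 3)) <|
        .seq (.plus (auxReg k) (auxReg k) (auxReg (k + 3))) <|
        .seq (.const (auxReg (k + 2)) 1) <|
        .seq (.plus (varReg i) (varReg i) (auxReg (k + 2))) <|
        .minus (auxReg (k + 2)) 0 (varReg i)) <|
      move (varReg i) (auxReg (k + 1)) (auxReg (k + 2))

/-- A bound for the number of steps for the evaluation of an expression. -/
noncomputable def Exp.time : Exp → Polynomial ℕ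
  | var _ => 2
  | lit _ => 1
  | size => 2
  | add a b => a.time + b.time + 1
  | sub a b => a.time + b.time + 1
  | get _ e => e.time + 1
  -- Each round costs the evaluation, four instructions and one test. The constant 7 counts two
  -- moves of two steps, two initialisations and the last test.
  | sum _ e => Polynomial.X * (e.time + 5) + 7

/-- Structural induction with k and the store kept general: intermediate results below k survive
since subexpressions use higher registers, and the body of a sum is evaluated in stores with a
changed bound variable. -/
theorem Exp.exec_compile {n : ℕ} (e : Exp) : ∀ (k : ℕ) (σ s : State), Represents n σ s →
    ∃ s' t, Exec (e.compile k) s s' t ∧ t ≤ e.time.eval n ∧ Represents n σ s' ∧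
      s'.reg (auxReg k) = e.eval n σ ∧ AuxAgree k s s' := by
  induction e with
  | var x =>
    intro k σ s h
    refine ⟨_, 2, exec_move _ _ _ s (by simp), by simp [Exp.time], h.setAux.setAux, ?_,
      ((AuxAgree.refl k s).setAux (by omega)).setAux le_rfl⟩
    simp [Exp.eval, h.2.1 x]
  | lit c =>
    intro k σ s h
    exact ⟨_, 1, .const _ _ s, by simp [Exp.time], h.setAux, by simp [Exp.eval],
      (AuxAgree.refl k s).setAux le_rfl⟩
  | size =>
    intro k σ s h
    refine ⟨_, 2, exec_move _ _ _ s (by simp), by simp [Exp.time], h.setAux.setAux, ?_,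
      ((AuxAgree.refl k s).setAux (by omega)).setAux le_rfl⟩
    simp [Exp.eval, h.1]
  | add a b iha ihb =>
    intro k σ s h
    obtain ⟨s₁, t₁, h₁, ht₁, hr₁, hv₁, ha₁⟩ := iha k σ s h
    obtain ⟨s₂, t₂, h₂, ht₂, hr₂, hv₂, ha₂⟩ := ihb (k + 1) σ s₁ hr₁
    refine ⟨_, _, .seq h₁ (.seq h₂ (.plus _ _ _ s₂)), ?_, hr₂.setAux, ?_,
      (ha₁.trans (ha₂.mono (by omega))).setAux le_rfl⟩
    · simp only [Exp.time, Polynomial.eval_add, Polynomial.eval_one]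
      omega
    · simp [Exp.eval, hv₂, ha₂ k (by omega), hv₁]
  | sub a b iha ihb =>
    intro k σ s h
    obtain ⟨s₁, t₁, h₁, ht₁, hr₁, hv₁, ha₁⟩ := iha k σ s h
    obtain ⟨s₂, t₂, h₂, ht₂, hr₂, hv₂, ha₂⟩ := ihb (k + 1) σ s₁ hr₁
    refine ⟨_, _, .seq h₁ (.seq h₂ (.minus _ _ _ s₂)), ?_, hr₂.setAux, ?_,
      (ha₁.trans (ha₂.mono (by omega))).setAux le_rfl⟩
    · simp only [Exp.time, Polynomial.eval_add, Polynomial.eval_one]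
      omega
    · simp [Exp.eval, hv₂, ha₂ k (by omega), hv₁]
  | get A e ih =>
    intro k σ s h
    obtain ⟨s₁, t₁, h₁, ht₁, hr₁, hv₁, ha₁⟩ := ih k σ s h
    refine ⟨_, _, .seq h₁ (.load _ _ _ s₁), ?_, hr₁.setAux, ?_, ha₁.setAux le_rfl⟩
    · simp only [Exp.time, Polynomial.eval_add, Polynomial.eval_one]
      omega
    · simp [Exp.eval, hv₁, hr₁.2.2]
  | sum i e ih =>
    intro k σ s h
    set body : Ram := .seq (e.compile (k + 3)) <|
        .seq (.plus (auxReg k) (auxReg k) (auxReg (k + 3))) <|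
        .seq (.const (auxReg (k + 2)) 1) <|
        .seq (.plus (varReg i) (varReg i) (auxReg (k + 2))) <|
        .minus (auxReg (k + 2)) 0 (varReg i) with hbody
    -- Induction on the number d of remaining rounds; after j rounds the accumulator holds the sum
    -- of the first j terms.
    have key : ∀ d j s, j + d = n → Represents n (σ.setReg i j) s →
        s.reg (auxReg (k + 2)) = d →
        s.reg (auxReg k) = ∑ x ∈ Finset.range j, e.eval n (σ.setReg i x) →
        ∃ s' t, Exec (.loop (auxReg (k + 2)) body) s s' t ∧ t ≤ d * (e.time.eval n + 5) + 1 ∧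
          Represents n (σ.setReg i n) s' ∧
          s'.reg (auxReg k) = ∑ x ∈ Finset.range n, e.eval n (σ.setReg i x) ∧
          s'.reg (auxReg (k + 1)) = s.reg (auxReg (k + 1)) ∧ AuxAgree k s s' := by
      intro d
      induction d with
      | zero =>
        intro j s hj hr hd hsum
        obtain rfl : j = n := by omega
        exact ⟨s, 1, .loopDone hd, by simp, hr, hsum, rfl, .refl _ _⟩
      | succ d ihd =>
        intro j s hj hr hd hsum
        obtain ⟨s₁, t₁, h₁, ht₁, hr₁, hv₁, ha₁⟩ := ih (k + 3) _ s hr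
        set s₂ := s₁.setReg (auxReg k) (s₁.reg (auxReg k) + s₁.reg (auxReg (k + 3))) with hs₂
        set s₃ := s₂.setReg (auxReg (k + 2)) 1 with hs₃
        set s₄ := s₃.setReg (varReg i) (s₃.reg (varReg i) + s₃.reg (auxReg (k + 2))) with hs₄
        set s₅ := s₄.setReg (auxReg (k + 2)) (s₄.reg 0 - s₄.reg (varReg i)) with hs₅
        have hex : Exec body s s₅ (t₁ + (1 + (1 + (1 + 1)))) :=
          .seq h₁ (.seq (.plus _ _ _ s₁) (.seq (.const _ _ s₂) (.seq (.plus _ _ _ s₃)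
            (.minus _ _ _ s₄))))
        have hi₁ : s₁.reg (varReg i) = j := by simp [hr₁.2.1 i]
        have hi₄ : s₄.reg (varReg i) = j + 1 := by simp [hs₄, hs₃, hs₂, hi₁]
        have h0₄ : s₄.reg 0 = n := by simp [hs₄, hs₃, hs₂, hr₁.1]
        have hr₅ : Represents n (σ.setReg i (j + 1)) s₅ := by
          have h3 : Represents n (σ.setReg i j) s₃ := hr₁.setAux.setAux
          have h4 := (h3.setVar (v := i) (x := j + 1)).setAux (k := k + 2)
            (x := s₄.reg 0 - s₄.reg (varReg i))
          have e1 : (σ.setReg i j).setReg i (j + 1) = σ.setReg i (j + 1) := by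
            refine State.ext' (fun r => ?_) rfl
            simp only [State.setReg_reg]
            split_ifs <;> rfl
          have e2 : s₃.setReg (varReg i) (j + 1) = s₄ := by
            rw [hs₄]
            congr 1
            simp [hs₃, hs₂, hi₁]
          rw [e1, e2] at h4
          exact h4
        have hd₅ : s₅.reg (auxReg (k + 2)) = d := by
          rw [hs₅]
          simp only [State.setReg_reg, if_true, hi₄, h0₄]
          omega
        have hk₁ : s₁.reg (auxReg k) = s.reg (auxReg k) := ha₁ k (by omega)
        have hsum₅ : s₅.reg (auxReg k) = ∑ x ∈ Finset.range (j + 1), e.eval n (σ.setReg i x) := by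
          rw [Finset.sum_range_succ, ← hsum, ← hv₁, ← hk₁]
          simp [hs₅, hs₄, hs₃, hs₂]
        obtain ⟨s', t, hl, ht, hr', hsum', hk', ha'⟩ := ihd (j + 1) s₅ (by omega) hr₅ hd₅ hsum₅
        refine ⟨s', _, .loopStep (by omega) hex hl, ?_, hr', hsum', ?_, ?_⟩
        · rw [Nat.succ_mul]
          omega
        · rw [hk', ← ha₁ (k + 1) (by omega)]
          simp [hs₅, hs₄, hs₃, hs₂]
        · refine AuxAgree.trans ?_ ha'
          exact ((((ha₁.mono (by omega)).setAux le_rfl).setAux (by omega)).setVar).setAux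
            (by omega)
    set s₁ := (s.setReg (auxReg k) 0).setReg (auxReg (k + 1)) (s.reg (varReg i)) with hs₁
    set s₂ := s₁.setReg (varReg i) 0 with hs₂
    set s₃ := s₂.setReg (auxReg (k + 2)) (s₂.reg 0 - s₂.reg (varReg i)) with hs₃
    have hr₃ : Represents n (σ.setReg i 0) s₃ := h.setAux.setAux.setVar.setAux
    have h0 : s₂.reg 0 = n := by simp [hs₂, hs₁, h.1]
    obtain ⟨s₄, t₄, h₄, ht₄, hr₄, hv₄, hk₄, ha₄⟩ := key n 0 s₃ (by omega) hr₃
      (by rw [hs₃]; simp only [State.setReg_reg, if_true, h0]; simp [hs₂])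
      (by simp [hs₃, hs₂, hs₁])
    have hk₃ : s₃.reg (auxReg (k + 1)) = σ.reg i := by
      simp [hs₃, hs₂, hs₁, h.2.1 i]
    refine ⟨_, _, .seq (exec_move _ _ _ s (by simp)) (.seq (.const _ _ s₁)
      (.seq (.minus _ _ _ s₂) (.seq h₄ (exec_move _ _ _ s₄ (by simp))))), ?_, ?_, ?_, ?_⟩
    · simp only [Exp.time, Polynomial.eval_add, Polynomial.eval_mul, Polynomial.eval_X,
        Polynomial.eval_ofNat]
      omega
    · have h5 := (hr₄.setAux (k := k + 2) (x := 0)).setVar (v := i) (x := s₄.reg (auxReg (k + 1)))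
      have e1 : (σ.setReg i n).setReg i (s₄.reg (auxReg (k + 1))) = σ := by
        refine State.ext' (fun r => ?_) rfl
        simp only [State.setReg_reg, hk₄, hk₃]
        split_ifs with hr
        · rw [hr]
        · rfl
      rw [e1] at h5
      exact h5
    · simp [Exp.eval, hv₄]
    · refine ((AuxAgree.trans ?_ ha₄).setAux (by omega)).setVar
      exact ((((AuxAgree.refl k s).setAux le_rfl).setAux (by omega)).setVar).setAux (by omega)

/-- Code for a loop program that uses no auxiliary register below `k`. -/
def Cmd.compile : Cmd → ℕ → Ram
  | assign x e, k => .seq (e.compile k) (move (varReg x) (auxReg k) (auxReg (k + 1)))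
  | write A i e, k => .seq (i.compile k) (.seq (e.compile (k + 1))
      (.store A (auxReg k) (auxReg (k + 1))))
  | seq p q, k => .seq (p.compile k) (q.compile k)
  | ite e p q, k => .seq (e.compile k) (.cond (auxReg k) (p.compile k) (q.compile k))
  | skip, k => .const (auxReg k) 0
  | loop i p, k =>
      -- The true counter is register k; it is copied into the loop variable in every round, so the
      -- body may overwrite that variable.
      .seq (.const (auxReg k) 0) <|
      .seq (.minus (auxReg (k + 1)) 0 (auxReg k)) <|
      .loop (auxReg (k + 1)) <|
        .seq (move (varReg i) (auxReg k) (auxReg (k + 1))) <|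
        .seq (p.compile (k + 1)) <|
        .seq (.const (auxReg (k + 1)) 1) <|
        .seq (.plus (auxReg k) (auxReg k) (auxReg (k + 1))) <|
        .minus (auxReg (k + 1)) 0 (auxReg k)

/-- A bound for the number of steps of a loop program. -/
noncomputable def Cmd.time : Cmd → Polynomial ℕ
  | assign _ e => e.time + 2
  | write _ i e => i.time + e.time + 1
  | seq p q => p.time + q.time
  | ite e p q => e.time + p.time + q.time + 1
  | skip => 1
  | loop _ p => Polynomial.X * (p.time + 6) + 3

/-- All loops have length n, fixed in register 0, so the time bound multiplies by n once per nesting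
level and termination is automatic. -/
theorem Cmd.exec_compile {n : ℕ} (p : Cmd) : ∀ (k : ℕ) (σ s : State), Represents n σ s →
    ∃ s' t, Exec (p.compile k) s s' t ∧ t ≤ p.time.eval n ∧ Represents n (p.run n σ) s' ∧
      AuxAgree k s s' := by
  induction p with
  | assign x e =>
    intro k σ s h
    obtain ⟨s₁, t₁, h₁, ht₁, hr₁, hv₁, ha₁⟩ := e.exec_compile k σ s h
    refine ⟨_, _, .seq h₁ (exec_move _ _ _ s₁ (by simp)), ?_, ?_, (ha₁.setAux (by omega)).setVar⟩
    · simp only [Cmd.time, Polynomial.eval_add, Polynomial.eval_ofNat]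
      omega
    · rw [hv₁]
      exact hr₁.setAux.setVar
  | write A i e =>
    intro k σ s h
    obtain ⟨s₁, t₁, h₁, ht₁, hr₁, hv₁, ha₁⟩ := i.exec_compile k σ s h
    obtain ⟨s₂, t₂, h₂, ht₂, hr₂, hv₂, ha₂⟩ := e.exec_compile (k + 1) σ s₁ hr₁
    refine ⟨_, _, .seq h₁ (.seq h₂ (.store _ _ _ s₂)), ?_, ?_,
      ha₁.trans (ha₂.mono (by omega))⟩
    · simp only [Cmd.time, Polynomial.eval_add, Polynomial.eval_one]
      omega
    · rw [hv₂, ha₂ k (by omega), hv₁]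
      exact hr₂.setArr
  | seq p q ihp ihq =>
    intro k σ s h
    obtain ⟨s₁, t₁, h₁, ht₁, hr₁, ha₁⟩ := ihp k σ s h
    obtain ⟨s₂, t₂, h₂, ht₂, hr₂, ha₂⟩ := ihq k _ s₁ hr₁
    refine ⟨_, _, .seq h₁ h₂, ?_, hr₂, ha₁.trans ha₂⟩
    simp only [Cmd.time, Polynomial.eval_add]
    omega
  | ite e p q ihp ihq =>
    intro k σ s h
    obtain ⟨s₁, t₁, h₁, ht₁, hr₁, hv₁, ha₁⟩ := e.exec_compile k σ s h
    by_cases he : e.eval n σ = 0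
    · obtain ⟨s₂, t₂, h₂, ht₂, hr₂, ha₂⟩ := ihq k σ s₁ hr₁
      refine ⟨_, _, .seq h₁ (.condFalse (by rw [hv₁, he]) h₂), ?_, ?_, ha₁.trans ha₂⟩
      · simp only [Cmd.time, Polynomial.eval_add, Polynomial.eval_one]
        omega
      · rw [Cmd.run, if_neg (by simpa using he)]
        exact hr₂
    · obtain ⟨s₂, t₂, h₂, ht₂, hr₂, ha₂⟩ := ihp k σ s₁ hr₁
      refine ⟨_, _, .seq h₁ (.condTrue (by rwa [hv₁]) h₂), ?_, ?_, ha₁.trans ha₂⟩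
      · simp only [Cmd.time, Polynomial.eval_add, Polynomial.eval_one]
        omega
      · rw [Cmd.run, if_pos he]
        exact hr₂
  | skip =>
    intro k σ s h
    exact ⟨_, 1, .const _ _ s, by simp [Cmd.time], h.setAux, (AuxAgree.refl k s).setAux le_rfl⟩
  | loop i p ih =>
    intro k σ s h
    set body : Ram := .seq (move (varReg i) (auxReg k) (auxReg (k + 1))) <|
        .seq (p.compile (k + 1)) <|
        .seq (.const (auxReg (k + 1)) 1) <|
        .seq (.plus (auxReg k) (auxReg k) (auxReg (k + 1))) <|
        .minus (auxReg (k + 1)) 0 (auxReg k) with hbody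
    have key : ∀ d j s, j + d = n →
        Represents n (iterate (fun x s => p.run n (s.setReg i x)) j σ) s →
        s.reg (auxReg (k + 1)) = d → s.reg (auxReg k) = j →
        ∃ s' t, Exec (.loop (auxReg (k + 1)) body) s s' t ∧ t ≤ d * (p.time.eval n + 6) + 1 ∧
          Represents n (iterate (fun x s => p.run n (s.setReg i x)) n σ) s' ∧
          AuxAgree k s s' := by
      intro d
      induction d with
      | zero =>
        intro j s hj hr hd _
        obtain rfl : j = n := by omega
        exact ⟨s, 1, .loopDone hd, by simp, hr, .refl _ _⟩
      | succ d ihd =>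
        intro j s hj hr hd hk
        set s₁ := (s.setReg (auxReg (k + 1)) 0).setReg (varReg i) (s.reg (auxReg k)) with hs₁
        have hr₁ : Represents n
            ((iterate (fun x s => p.run n (s.setReg i x)) j σ).setReg i j) s₁ := by
          rw [hs₁, hk]
          exact hr.setAux.setVar
        obtain ⟨s₂, t₂, h₂, ht₂, hr₂, ha₂⟩ := ih (k + 1) _ s₁ hr₁
        set s₃ := s₂.setReg (auxReg (k + 1)) 1 with hs₃
        set s₄ := s₃.setReg (auxReg k) (s₃.reg (auxReg k) + s₃.reg (auxReg (k + 1))) with hs₄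
        set s₅ := s₄.setReg (auxReg (k + 1)) (s₄.reg 0 - s₄.reg (auxReg k)) with hs₅
        have hex : Exec body s s₅ (2 + (t₂ + (1 + (1 + 1)))) :=
          .seq (exec_move _ _ _ s (by simp)) (.seq h₂ (.seq (.const _ _ s₂) (.seq (.plus _ _ _ s₃)
            (.minus _ _ _ s₄))))
        have hk₂ : s₂.reg (auxReg k) = j := by
          rw [ha₂ k (by omega)]
          simp [hs₁, hk]
        have hk₄ : s₄.reg (auxReg k) = j + 1 := by simp [hs₄, hs₃, hk₂]
        have h0₄ : s₄.reg 0 = n := by simp [hs₄, hs₃, hr₂.1]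
        obtain ⟨s', t, hl, ht, hr', ha'⟩ := ihd (j + 1) s₅ (by omega)
          hr₂.setAux.setAux.setAux
          (by rw [hs₅]; simp only [State.setReg_reg, if_true, hk₄, h0₄]; omega)
          (by rw [hs₅, State.setReg_reg, if_neg (by simp), hk₄])
        refine ⟨s', _, .loopStep (by omega) hex hl, ?_, hr', AuxAgree.trans ?_ ha'⟩
        · rw [Nat.succ_mul]
          omega
        · refine (((AuxAgree.trans ?_ (ha₂.mono (by omega))).setAux (by omega)).setAux
            le_rfl).setAux (by omega)
          exact ((AuxAgree.refl k s).setAux (by omega)).setVar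
    set s₁ := s.setReg (auxReg k) 0 with hs₁
    set s₂ := s₁.setReg (auxReg (k + 1)) (s₁.reg 0 - s₁.reg (auxReg k)) with hs₂
    obtain ⟨s', t, hl, ht, hr', ha'⟩ := key n 0 s₂ (by omega) h.setAux.setAux
      (by simp [hs₂, hs₁, h.1]) (by simp [hs₂, hs₁])
    refine ⟨s', _, .seq (.const _ _ s) (.seq (.minus _ _ _ s₁) hl), ?_, hr',
      AuxAgree.trans ?_ ha'⟩
    · simp only [Cmd.time, Polynomial.eval_add, Polynomial.eval_mul, Polynomial.eval_X,
        Polynomial.eval_ofNat]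
      omega
    · exact ((AuxAgree.refl k s).setAux le_rfl).setAux (by omega)

/-- The store on which a loop program for graphs is started. -/
noncomputable def initialStore {n : ℕ} (G : SimpleGraph (Fin n)) : State where
  reg _ := 0
  arr := (graphInput G).arr

/-- A loop program that leaves the length of its output in variable `x` and the output in
array `1` yields a program of a random access machine with polynomial running time. -/
theorem Cmd.exists_ram (p : Cmd) (x : ℕ) : ∃ (P : Ram) (q : Polynomial ℕ),
    ∀ (n : ℕ) (G : SimpleGraph (Fin n)) (w : List ℕ),
      (p.run n (initialStore G)).reg x = w.length →
      (∀ k (h : k < w.length), (p.run n (initialStore G)).arr 1 k = w[k]) →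
      ∃ (s : State) (t : ℕ), Exec P (graphInput G) s t ∧ t ≤ q.eval n ∧ HoldsOutput s w := by
  -- Only now is n in register 0 overwritten, by the length of the output.
  refine ⟨.seq (p.compile 0) (move 0 (varReg x) (auxReg 0)), p.time + 2, fun n G w hl hw => ?_⟩
  obtain ⟨s, t, hs, ht, hr, -⟩ := p.exec_compile (n := n) 0 (initialStore G) (graphInput G)
    ⟨by simp [graphInput], fun y => by simp [graphInput, initialStore], rfl⟩
  refine ⟨_, _, .seq hs (exec_move _ _ _ s (by simp)), ?_, ?_, ?_⟩
  · simp only [Polynomial.eval_add, Polynomial.eval_ofNat]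
    omega
  · simp [hr.2.1 x, hl]
  · intro k hk
    simp [hr.2.2, hw k hk]

/-! ### Derived expressions and reasoning about loops -/

open Ram (State)

namespace Exp

/-- Negation. -/
def not (e : Exp) : Exp := sub (lit 1) e
/-- Conjunction. -/
def and (a b : Exp) : Exp := not (add (not a) (not b))
/-- Disjunction. -/
def or (a b : Exp) : Exp := add a b
/-- Strict comparison. -/
def lt (a b : Exp) : Exp := sub b a
/-- Disequality. -/
def ne (a b : Exp) : Exp := add (sub a b) (sub b a)
/-- Equality. -/
def eq (a b : Exp) : Exp := not (ne a b)
/-- The truth value `0` or `1`. -/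
def ind (e : Exp) : Exp := not (not e)
/-- The minimum of two numbers. -/
def min (a b : Exp) : Exp := sub a (sub a b)
/-- The row-major index of a matrix entry whose coordinates are variables. Variable `0` is only
used as the bound variable of the sum that stands for the product with the size. -/
def idx (x y : ℕ) : Exp := add (sum 0 (var x)) (var y)

/-- An expression is true if its value is not zero. -/
def Holds (n : ℕ) (e : Exp) (s : State) : Prop := e.eval n s ≠ 0

variable {n : ℕ} {s : State}

@[simp] theorem eval_var (x : ℕ) : (var x).eval n s = s.reg x := rfl
@[simp] theorem eval_lit (c : ℕ) : (lit c).eval n s = c := rfl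
@[simp] theorem eval_add (a b : Exp) : (add a b).eval n s = a.eval n s + b.eval n s := rfl
@[simp] theorem eval_sub (a b : Exp) : (sub a b).eval n s = a.eval n s - b.eval n s := rfl
@[simp] theorem eval_get (A : ℕ) (e : Exp) : (get A e).eval n s = s.arr A (e.eval n s) := rfl
@[simp] theorem eval_sum (i : ℕ) (e : Exp) :
    (sum i e).eval n s = ∑ x : Fin n, e.eval n (s.setReg i x) :=
  Finset.sum_range fun x => e.eval n (s.setReg i x)

@[simp] theorem eval_min (a b : Exp) : (min a b).eval n s = Min.min (a.eval n s) (b.eval n s) := by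
  simp only [min, eval_sub]
  omega

/-- The product with n is a sum of n equal terms; x must differ from the bound variable 0 for these
terms to be constant. -/
theorem eval_idx {x y : ℕ} (hx : x ≠ 0) : (idx x y).eval n s = s.reg x * n + s.reg y := by
  simp [idx, hx, mul_comm]

@[simp] theorem holds_var (x : ℕ) : (var x).Holds n s ↔ s.reg x ≠ 0 := Iff.rfl

@[simp] theorem holds_get (A : ℕ) (e : Exp) :
    (get A e).Holds n s ↔ s.arr A (e.eval n s) ≠ 0 := Iff.rfl

@[simp] theorem holds_not (e : Exp) : e.not.Holds n s ↔ ¬ e.Holds n s := by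
  simp only [Holds, not, eval_sub, eval_lit]
  omega

@[simp] theorem holds_or (a b : Exp) : (a.or b).Holds n s ↔ a.Holds n s ∨ b.Holds n s := by
  simp only [Holds, or, eval_add]
  omega

@[simp] theorem holds_and (a b : Exp) : (a.and b).Holds n s ↔ a.Holds n s ∧ b.Holds n s := by
  have : (a.and b).Holds n s ↔ ¬ (a.not.or b.not).Holds n s := holds_not _
  rw [this, holds_or, holds_not, holds_not]
  tauto

@[simp] theorem holds_lt (a b : Exp) : (a.lt b).Holds n s ↔ a.eval n s < b.eval n s := by
  simp only [Holds, lt, eval_sub]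
  omega

@[simp] theorem holds_ne (a b : Exp) : (a.ne b).Holds n s ↔ a.eval n s ≠ b.eval n s := by
  simp only [Holds, ne, eval_sub, eval_add]
  omega

@[simp] theorem holds_eq (a b : Exp) : (a.eq b).Holds n s ↔ a.eval n s = b.eval n s := by
  simp [eq]

@[simp] theorem holds_sum (i : ℕ) (e : Exp) :
    (sum i e).Holds n s ↔ ∃ x : Fin n, e.Holds n (s.setReg i x) := by
  simp [Holds]

open Classical in
@[simp] theorem eval_ind (e : Exp) : e.ind.eval n s = if e.Holds n s then 1 else 0 := by
  have h : e.ind.eval n s = 1 - (1 - e.eval n s) := rfl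
  by_cases he : e.eval n s = 0
  · rw [h, if_neg (show ¬ e.Holds n s from fun h' => h' he)]
    omega
  · rw [h, if_pos (show e.Holds n s from he)]
    omega

end Exp

namespace Cmd

variable {n : ℕ}

/-- The variables that a loop program may change. -/
def assigned : Cmd → List ℕ
  | assign x _ => [x]
  | write _ _ _ => []
  | seq p q => p.assigned ++ q.assigned
  | ite _ p q => p.assigned ++ q.assigned
  | skip => []
  | loop i p => i :: p.assigned

/-- The arrays that a loop program may change. -/
def written : Cmd → List ℕ
  | assign _ _ => []
  | write A _ _ => [A]
  | seq p q => p.written ++ q.written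
  | ite _ p q => p.written ++ q.written
  | skip => []
  | loop _ p => p.written

/-- Induction along the execution of a loop. -/
theorem run_loop_induct {p : Cmd} {i : ℕ} {s : State} (I : ℕ → State → Prop) (h0 : I 0 s)
    (hs : ∀ x < n, ∀ τ, I x τ → I (x + 1) (p.run n (τ.setReg i x))) :
    I n ((loop i p).run n s) := by
  suffices ∀ k ≤ n, I k (iterate (fun x s => p.run n (s.setReg i x)) k s) from this n le_rfl
  intro k
  induction k with
  | zero => exact fun _ => h0
  | succ k ih => exact fun hk => hs k (by omega) _ (ih (by omega))

/-- Frame property; for concrete programs the side condition is settled by `decide`. -/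
theorem run_reg (p : Cmd) {x : ℕ} (hx : x ∉ p.assigned) (s : State) :
    (p.run n s).reg x = s.reg x := by
  induction p generalizing s with
  | assign y e =>
    simp only [assigned, List.mem_singleton] at hx
    simp [run, hx]
  | write A i e => rfl
  | seq p q ihp ihq =>
    simp only [assigned, List.mem_append, not_or] at hx
    rw [run, ihq hx.2, ihp hx.1]
  | ite e p q ihp ihq =>
    simp only [assigned, List.mem_append, not_or] at hx
    rw [run]
    split_ifs
    · exact ihp hx.1 s
    · exact ihq hx.2 s
  | skip => rfl
  | loop i p ih =>
    simp only [assigned, List.mem_cons, not_or] at hx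
    refine run_loop_induct (fun _ τ => τ.reg x = s.reg x) rfl fun y _ τ hτ => ?_
    rw [ih hx.2]
    simp [hx.1, hτ]

theorem run_arr (p : Cmd) {A : ℕ} (hA : A ∉ p.written) (s : State) :
    (p.run n s).arr A = s.arr A := by
  induction p generalizing s with
  | assign y e => rfl
  | write B i e =>
    simp only [written, List.mem_singleton] at hA
    funext k
    simp [run, hA]
  | seq p q ihp ihq =>
    simp only [written, List.mem_append, not_or] at hA
    rw [run, ihq hA.2, ihp hA.1]
  | ite e p q ihp ihq =>
    simp only [written, List.mem_append, not_or] at hA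
    rw [run]
    split_ifs
    · exact ihp hA.1 s
    · exact ihq hA.2 s
  | skip => rfl
  | loop i p ih =>
    refine run_loop_induct (fun _ τ => τ.arr A = s.arr A) rfl fun y _ τ hτ => ?_
    rw [ih hA, State.setReg_arr, hτ]

open Classical in
theorem run_ite (e : Exp) (p q : Cmd) (s : State) :
    (ite e p q).run n s = if e.Holds n s then p.run n s else q.run n s := by
  by_cases h : e.eval n s = 0
  · rw [run, if_neg (fun h' => h' h), if_neg (show ¬ e.Holds n s from fun h' => h' h)]
  · rw [run, if_pos h, if_pos (show e.Holds n s from h)]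

/-- A loop that fills an array with values that do not depend on this array. -/
theorem run_loop_write {A i : ℕ} {e : Exp} {s : State} {f : ℕ → ℕ}
    (hf : ∀ x < n, ∀ τ : State, (∀ r, r ≠ i → τ.reg r = s.reg r) →
      (∀ B, B ≠ A → τ.arr B = s.arr B) → τ.reg i = x → e.eval n τ = f x) {x : ℕ} (hx : x < n) :
    ((loop i (write A (.var i) e)).run n s).arr A x = f x := by
  refine (run_loop_induct (n := n) (fun k τ => (∀ r, r ≠ i → τ.reg r = s.reg r) ∧
    (∀ B, B ≠ A → τ.arr B = s.arr B) ∧ ∀ y < k, τ.arr A y = f y)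
    ⟨fun _ _ => rfl, fun _ _ => rfl, fun y hy => absurd hy (by omega)⟩ ?_).2.2 x hx
  rintro k hk τ ⟨h1, h2, h3⟩
  have hreg : ∀ r, r ≠ i → (τ.setReg i k).reg r = s.reg r := by
    intro r hr
    simp [hr, h1 r hr]
  refine ⟨hreg, ?_, ?_⟩
  · intro B hB
    funext l
    simp [run, hB, h2 B hB]
  · intro y hy
    have hv := hf k hk (τ.setReg i k) hreg h2 (by simp)
    simp only [run, State.setArr_arr, Exp.eval_var, State.setReg_reg, State.setReg_arr, hv,
      true_and, if_true]
    split_ifs with h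
    · rw [h]
    · exact h3 y (by omega)

end Cmd

/-! ### Adjacency in the store -/

open Classical in
theorem graphInput_arr {n : ℕ} (G : SimpleGraph (Fin n)) (u v : Fin n) :
    (Ram.graphInput G).arr 0 (u * n + v) = if G.Adj u v then 1 else 0 := by
  simp only [Ram.graphInput, true_and]
  refine if_congr ⟨?_, fun h => ⟨u, v, rfl, h⟩⟩ rfl rfl
  rintro ⟨i, j, h, hadj⟩
  have : (u, v) = (i, j) := pairCode_injective h
  simp only [Prod.mk.injEq] at this
  rwa [this.1, this.2]

open Classical in
theorem arr_zero_eq {n : ℕ} {G : SimpleGraph (Fin n)} {s : State}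
    (h : s.arr 0 = (Ram.graphInput G).arr 0) (u v : Fin n) :
    s.arr 0 (u * n + v) = if G.Adj u v then 1 else 0 := by
  rw [h, graphInput_arr]

theorem arr_zero_ne {n : ℕ} {G : SimpleGraph (Fin n)} {s : State}
    (h : s.arr 0 = (Ram.graphInput G).arr 0) (u v : Fin n) :
    s.arr 0 (u * n + v) ≠ 0 ↔ G.Adj u v := by
  rw [arr_zero_eq h]
  simp

open Ram (State)

/-! ### The implication classes -/

namespace Cmd

open Exp

/-- Initially every pair of vertices has its own code. -/
def initClasses : Cmd := loop 1 (loop 2 (write 2 (idx 1 2) (idx 1 2)))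

/-- The condition that `(a, b)` forces `(a, c)`, where `a`, `b`, `c` are the variables 1, 2, 3. -/
def forcesExp : Exp :=
  ((((var 1).ne (var 2)).and ((get 0 (idx 1 2)).not)).and
    (((var 1).ne (var 3)).and ((get 0 (idx 1 3)).not))).and (get 0 (idx 2 3))

/-- Propagation of a value along a forcing and its reversal. -/
def relaxOne : Cmd :=
  ite forcesExp
    (seq (write 2 (idx 1 3) ((get 2 (idx 1 3)).min (get 2 (idx 1 2))))
      (write 2 (idx 3 1) ((get 2 (idx 3 1)).min (get 2 (idx 2 1)))))
    skip

/-- Propagation along all forcings. -/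
def relaxAll : Cmd := loop 1 (loop 2 (loop 3 relaxOne))

/-- Propagation in `n * n` rounds. -/
def relaxRounds : Cmd := loop 4 (loop 5 relaxAll)

end Cmd

/-- The matrix stored in array `2`. -/
def pairValue {n : ℕ} (s : State) (p : Fin n × Fin n) : ℕ := s.arr 2 (pairCode p)

/-- All values are codes of pairs in the right implication class. -/
def Sound {n : ℕ} (G : SimpleGraph (Fin n)) (s : State) : Prop :=
  ∀ p, ∃ q, G.SameClass p q ∧ pairValue s p = pairCode q

/-- The effect of lowering values along a relation `F`, starting from `s`. -/
structure Lowers {n : ℕ} (G : SimpleGraph (Fin n)) (F : Fin n × Fin n → Fin n × Fin n → Prop)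
    (s s' : State) : Prop where
  graph : s'.arr 0 = s.arr 0
  sound : Sound G s → Sound G s'
  le : ∀ p : Fin n × Fin n, pairValue s' p ≤ pairValue s p
  lower : ∀ p q, F p q → pairValue s' q ≤ pairValue s p

section classes

variable {n : ℕ} {G : SimpleGraph (Fin n)}

theorem Lowers.refl (s : State) : Lowers G (fun p q => p = q) s s :=
  ⟨rfl, id, fun _ => le_rfl, fun _ _ h => h ▸ le_rfl⟩

theorem pairValue_setArr (s : State) (p q : Fin n × Fin n) (x : ℕ) :
    pairValue (s.setArr 2 (pairCode p) x) q = if q = p then x else pairValue s q := by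
  simp only [pairValue, Ram.State.setArr_arr, true_and]
  exact if_congr pairCode_injective.eq_iff rfl rfl

/-- The new value at q is the old value at p or at q, in both cases the code of a member of the
class of q. -/
theorem Lowers.setArr (s : State) {p q : Fin n × Fin n} (h : G.SameClass q p) :
    Lowers G (fun p' q' => p' = p ∧ q' = q) s
      (s.setArr 2 (pairCode q) (min (pairValue s q) (pairValue s p))) where
  graph := by
    funext k
    simp
  sound hs r := by
    rw [pairValue_setArr]
    split_ifs with hr
    · subst hr
      rcases min_choice (pairValue s r) (pairValue s p) with hm | hm <;> rw [hm]
      · exact hs r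
      · obtain ⟨q', h1, h2⟩ := hs p
        exact ⟨q', h.trans h1, h2⟩
    · exact hs r
  le r := by
    rw [pairValue_setArr]
    split_ifs with hr
    · subst hr
      exact min_le_left _ _
    · exact le_rfl
  lower := by
    rintro p' q' ⟨rfl, rfl⟩
    rw [pairValue_setArr, if_pos rfl]
    exact min_le_right _ _

/-- Values never increase, so each bound survives the other command, and the two bounds can also be
chained. -/
theorem Lowers.comp {F F' H : Fin n × Fin n → Fin n × Fin n → Prop} {s s' s'' : State}
    (h : Lowers G F s s') (h' : Lowers G F' s' s'')
    (hH : ∀ p q, H p q → F p q ∨ F' p q ∨ ∃ r, F p r ∧ F' r q) : Lowers G H s s'' where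
  graph := h'.graph.trans h.graph
  sound hs := h'.sound (h.sound hs)
  le p := (h'.le p).trans (h.le p)
  lower p q hpq := by
    rcases hH p q hpq with h1 | h1 | ⟨r, h1, h2⟩
    · exact (h'.le q).trans (h.lower p q h1)
    · exact (h'.lower p q h1).trans (h.le p)
    · exact (h'.lower r q h2).trans (h.lower p r h1)

theorem Lowers.mono {F F' : Fin n × Fin n → Fin n × Fin n → Prop} {s s' : State}
    (h : Lowers G F s s') (hF : ∀ p q, F' p q → F p q) : Lowers G F' s s' :=
  ⟨h.graph, h.sound, h.le, fun p q hpq => h.lower p q (hF p q hpq)⟩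

theorem Lowers.of_setReg {F : Fin n × Fin n → Fin n × Fin n → Prop} {s s' : State} {i x : ℕ}
    (h : Lowers G F (s.setReg i x) s') : Lowers G F s s' :=
  ⟨h.graph, h.sound, h.le, h.lower⟩

/-- The effect of a loop is the union of the effects of its rounds. -/
theorem Lowers.run_loop {F : Fin n → Fin n × Fin n → Fin n × Fin n → Prop} {p : Cmd} {i : ℕ}
    {s : State} (I : State → Prop) (hI : I s)
    (hp : ∀ x : Fin n, ∀ τ, I τ → I (p.run n (τ.setReg i x)) ∧
      Lowers G (F x) (τ.setReg i x) (p.run n (τ.setReg i x))) :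
    Lowers G (fun a b => ∃ x, F x a b) s ((Cmd.loop i p).run n s) := by
  have := Cmd.run_loop_induct (n := n) (p := p) (i := i) (s := s)
    (fun k τ => I τ ∧ Lowers G (fun a b => ∃ x : Fin n, x.val < k ∧ F x a b) s τ)
    ⟨hI, rfl, id, fun _ => le_rfl, fun _ _ ⟨x, hx, _⟩ => absurd hx (by omega)⟩
    (fun k hk τ hτ => by
      obtain ⟨h1, h2⟩ := hp ⟨k, hk⟩ τ hτ.1
      refine ⟨h1, hτ.2.comp h2.of_setReg ?_⟩
      rintro a b ⟨x, hx, hF⟩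
      rcases (Nat.lt_succ_iff.1 hx).lt_or_eq with h | h
      · exact Or.inl ⟨x, h, hF⟩
      · obtain rfl : x = ⟨k, hk⟩ := Fin.ext h
        exact Or.inr (Or.inl hF))
  exact this.2.mono fun a b ⟨x, hF⟩ => ⟨x, x.2, hF⟩

/-- Two pairs are related if there is a chain of at most `k` forcings from one to the other. -/
def ForcesWithin (G : SimpleGraph (Fin n)) : ℕ → Fin n × Fin n → Fin n × Fin n → Prop
  | 0, p, q => p = q
  | k + 1, p, q => ∃ r, (r = p ∨ G.Forces p r) ∧ ForcesWithin G k r q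

theorem forcesWithin_add {k l : ℕ} {p q : Fin n × Fin n} (h : ForcesWithin G (k + l) p q) :
    ∃ r, ForcesWithin G k p r ∧ ForcesWithin G l r q := by
  induction k generalizing p with
  | zero => exact ⟨p, rfl, by simpa using h⟩
  | succ k ih =>
    rw [Nat.succ_add] at h
    obtain ⟨r, h1, h2⟩ := h
    obtain ⟨r', h3, h4⟩ := ih h2
    exact ⟨r', ⟨r, h1, h3⟩, h4⟩

theorem ForcesWithin.mono {k l : ℕ} (hkl : k ≤ l) {p q : Fin n × Fin n}
    (h : ForcesWithin G k p q) : ForcesWithin G l p q := by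
  induction k generalizing p l with
  | zero =>
    obtain rfl : p = q := h
    clear hkl
    induction l with
    | zero => rfl
    | succ l ih => exact ⟨p, Or.inl rfl, ih⟩
  | succ k ih =>
    obtain ⟨r, h1, h2⟩ := h
    obtain ⟨l, rfl⟩ : ∃ m, l = m + 1 := ⟨l - 1, by omega⟩
    exact ⟨r, h1, ih (by omega) h2⟩

/-- The graph of forcings. -/
def forcesGraph (G : SimpleGraph (Fin n)) : SimpleGraph (Fin n × Fin n) where
  Adj := G.Forces
  symm := ⟨fun _ _ h => h.symm⟩
  loopless := ⟨fun p h => by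
    cases h with
    | right h1 h2 h3 h4 h5 => exact h5.ne rfl
    | left h1 h2 h3 h4 h5 => exact h5.ne rfl⟩

/-- A chain of forcings can be shortened to a path in a graph with n * n vertices. This is why n * n
rounds of propagation suffice. -/
theorem SimpleGraph.SameClass.forcesWithin {p q : Fin n × Fin n} (h : G.SameClass p q) :
    ForcesWithin G (n * n) p q := by
  have hr : (forcesGraph G).Reachable p q :=
    ((forcesGraph G).reachable_iff_reflTransGen p q).2 h
  obtain ⟨w, hw⟩ := hr.exists_isPath
  have hlen : w.length < n * n := by simpa using hw.length_lt
  refine ForcesWithin.mono hlen.le ?_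
  clear hlen hw h hr
  induction w with
  | nil => rfl
  | cons hadj w ih => exact ⟨_, Or.inr hadj, ih⟩

/-- Repeating a command that lowers along short chains lowers along long chains. -/
theorem Lowers.run_loop_forcesWithin {p : Cmd} {i k : ℕ} {s : State}
    (hs : s.arr 0 = (Ram.graphInput G).arr 0)
    (hp : ∀ τ, τ.arr 0 = (Ram.graphInput G).arr 0 →
      Lowers G (ForcesWithin G k) τ (p.run n τ)) :
    Lowers G (ForcesWithin G (n * k)) s ((Cmd.loop i p).run n s) := by
  refine Cmd.run_loop_induct (n := n) (p := p) (i := i) (s := s)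
    (fun j τ => Lowers G (ForcesWithin G (j * k)) s τ) ?_ ?_
  · rw [zero_mul]
    exact Lowers.refl s
  · intro x _ τ hτ
    have h1 : (τ.setReg i x).arr 0 = (Ram.graphInput G).arr 0 := hτ.graph.trans hs
    refine hτ.comp (hp _ h1).of_setReg fun a b hab => Or.inr (Or.inr ?_)
    rw [Nat.succ_mul] at hab
    exact forcesWithin_add hab

theorem holds_forcesExp {s : State} (hs : s.arr 0 = (Ram.graphInput G).arr 0) {a b c : Fin n}
    (ha : s.reg 1 = a) (hb : s.reg 2 = b) (hc : s.reg 3 = c) :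
    Cmd.forcesExp.Holds n s ↔
      ((a ≠ b ∧ ¬ G.Adj a b) ∧ (a ≠ c ∧ ¬ G.Adj a c)) ∧ G.Adj b c := by
  simp only [Cmd.forcesExp, Exp.holds_and, Exp.holds_ne, Exp.holds_not, Exp.holds_get,
    Exp.eval_var, Exp.eval_idx (n := n) (s := s) (show 1 ≠ 0 by omega),
    Exp.eval_idx (n := n) (s := s) (show 2 ≠ 0 by omega), ha, hb, hc, arr_zero_ne hs, ne_eq,
    Fin.ext_iff]

/-- Both writes are justified by one test, since a forcing and its mirror image have the same
condition. The second write reads the array as already changed by the first, which composition of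
lowerings permits. -/
theorem lowers_relaxOne {s : State} (hs : s.arr 0 = (Ram.graphInput G).arr 0) {a b c : Fin n}
    (ha : s.reg 1 = a) (hb : s.reg 2 = b) (hc : s.reg 3 = c) :
    Lowers G (fun p q => G.Forces p q ∧ ((p = (a, b) ∧ q = (a, c)) ∨ (p = (b, a) ∧ q = (c, a))))
      s (Cmd.relaxOne.run n s) := by
  rw [Cmd.relaxOne, Cmd.run_ite]
  split_ifs with h
  · rw [holds_forcesExp hs ha hb hc] at h
    obtain ⟨⟨⟨h1, h2⟩, h3, h4⟩, h5⟩ := h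
    have f1 : G.Forces (a, b) (a, c) := .right h1 h2 h3 h4 h5
    have f2 : G.Forces (b, a) (c, a) := .left h1 h2 h3 h4 h5
    have l1 := Lowers.setArr s f1.symm.sameClass
    have l2 := Lowers.setArr (s.setArr 2 (pairCode (a, c))
      (min (pairValue s (a, c)) (pairValue s (a, b)))) f2.symm.sameClass
    have hrun : (Cmd.seq
        (.write 2 (.idx 1 3) ((Exp.get 2 (.idx 1 3)).min (.get 2 (.idx 1 2))))
        (.write 2 (.idx 3 1) ((Exp.get 2 (.idx 3 1)).min (.get 2 (.idx 2 1))))).run n s =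
        (s.setArr 2 (pairCode (a, c)) (min (pairValue s (a, c)) (pairValue s (a, b)))).setArr 2
          (pairCode (c, a))
          (min (pairValue (s.setArr 2 (pairCode (a, c))
            (min (pairValue s (a, c)) (pairValue s (a, b)))) (c, a))
          (pairValue (s.setArr 2 (pairCode (a, c))
            (min (pairValue s (a, c)) (pairValue s (a, b)))) (b, a))) := by
      simp only [Cmd.run, Exp.eval_min, Exp.eval_get, pairValue, pairCode, ne_eq,
        OfNat.ofNat_ne_zero, one_ne_zero, not_false_eq_true, Exp.eval_idx, ha, hb, hc,
        Ram.State.setArr_reg]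
    rw [hrun]
    refine l1.comp l2 ?_
    rintro p q ⟨-, h | h⟩
    · exact Or.inl h
    · exact Or.inr (Or.inl h)
  · have : ∀ p q : Fin n × Fin n, G.Forces p q →
        ¬ ((p = (a, b) ∧ q = (a, c)) ∨ (p = (b, a) ∧ q = (c, a))) := by
      rintro p q hpq hcon
      apply h
      rw [holds_forcesExp hs ha hb hc]
      rcases hcon with ⟨rfl, rfl⟩ | ⟨rfl, rfl⟩
      · cases hpq with
        | right h1 h2 h3 h4 h5 => exact ⟨⟨⟨h1, h2⟩, h3, h4⟩, h5⟩
        | left h1 h2 h3 h4 h5 => exact absurd rfl h5.ne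
      · cases hpq with
        | right h1 h2 h3 h4 h5 => exact absurd rfl h5.ne
        | left h1 h2 h3 h4 h5 => exact ⟨⟨⟨h1, h2⟩, h3, h4⟩, h5⟩
    exact ⟨rfl, id, fun _ => le_rfl, fun p q hpq => absurd hpq.2 (this p q hpq.1)⟩

theorem lowers_relaxAll {s : State} (hs : s.arr 0 = (Ram.graphInput G).arr 0) :
    Lowers G (ForcesWithin G 1) s (Cmd.relaxAll.run n s) := by
  let F : Fin n → Fin n → Fin n → Fin n × Fin n → Fin n × Fin n → Prop := fun a b c p q =>
    G.Forces p q ∧ ((p = (a, b) ∧ q = (a, c)) ∨ (p = (b, a) ∧ q = (c, a)))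
  have l3 : ∀ a b : Fin n, ∀ τ : State, τ.arr 0 = (Ram.graphInput G).arr 0 → τ.reg 1 = a →
      τ.reg 2 = b →
      Lowers G (fun p q => ∃ c, F a b c p q) τ ((Cmd.loop 3 Cmd.relaxOne).run n τ) := by
    intro a b τ h0 h1 h2
    refine Lowers.run_loop (fun τ => τ.arr 0 = (Ram.graphInput G).arr 0 ∧ τ.reg 1 = a ∧
      τ.reg 2 = b) ⟨h0, h1, h2⟩ ?_
    rintro c τ ⟨h0, h1, h2⟩
    have l := lowers_relaxOne (s := τ.setReg 3 c) (a := a) (b := b) (c := c) h0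
      (by simpa using h1) (by simpa using h2) (by simp)
    refine ⟨⟨l.graph.trans h0, ?_, ?_⟩, l⟩
    · rw [Cmd.run_reg _ (by decide)]
      simpa using h1
    · rw [Cmd.run_reg _ (by decide)]
      simpa using h2
  have l2 : ∀ a : Fin n, ∀ τ : State, τ.arr 0 = (Ram.graphInput G).arr 0 → τ.reg 1 = a →
      Lowers G (fun p q => ∃ b c, F a b c p q) τ
        ((Cmd.loop 2 (Cmd.loop 3 Cmd.relaxOne)).run n τ) := by
    intro a τ h0 h1
    refine Lowers.run_loop (fun τ => τ.arr 0 = (Ram.graphInput G).arr 0 ∧ τ.reg 1 = a)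
      ⟨h0, h1⟩ ?_
    rintro b τ ⟨h0, h1⟩
    have l := l3 a b (τ.setReg 2 b) h0 (by simpa using h1) (by simp)
    refine ⟨⟨l.graph.trans h0, ?_⟩, l⟩
    rw [Cmd.run_reg _ (by decide)]
    simpa using h1
  have l1 : Lowers G (fun p q => ∃ a b c, F a b c p q) s (Cmd.relaxAll.run n s) := by
    refine Lowers.run_loop (fun τ => τ.arr 0 = (Ram.graphInput G).arr 0) hs ?_
    intro a τ h0
    have l := l2 a (τ.setReg 1 a) h0 (by simp)
    exact ⟨l.graph.trans h0, l⟩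
  refine ⟨l1.graph, l1.sound, l1.le, ?_⟩
  -- A chain of at most one forcing is either trivial, where monotonicity suffices, or one of the
  -- two forms of forcing given by a triple of vertices.
  rintro p q ⟨r, rfl | hr, rfl⟩
  · exact l1.le r
  · refine l1.lower p r ?_
    cases hr with
    | @right a b c h1 h2 h3 h4 h5 =>
      exact ⟨a, b, c, .right h1 h2 h3 h4 h5, Or.inl ⟨rfl, rfl⟩⟩
    | @left a b c h1 h2 h3 h4 h5 =>
      exact ⟨a, b, c, .left h1 h2 h3 h4 h5, Or.inr ⟨rfl, rfl⟩⟩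

theorem lowers_relaxRounds {s : State} (hs : s.arr 0 = (Ram.graphInput G).arr 0) :
    Lowers G (ForcesWithin G (n * n)) s (Cmd.relaxRounds.run n s) := by
  refine Lowers.run_loop_forcesWithin hs fun τ hτ => ?_
  have := Lowers.run_loop_forcesWithin (i := 5) hτ fun τ hτ => lowers_relaxAll hτ
  rwa [mul_one] at this

theorem pairValue_initClasses (s : State) (p : Fin n × Fin n) :
    pairValue (Cmd.initClasses.run n s) p = pairCode p := by
  have inner : ∀ (a : Fin n) (τ : State), τ.reg 1 = a →
      -- Every write stores an index in its own cell, so cells with this property keep it. Finished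
      -- rows are thus safe without showing that later writes miss them.
      (∀ k, τ.arr 2 k = k → ((Cmd.loop 2 (.write 2 (.idx 1 2) (.idx 1 2))).run n τ).arr 2 k = k) ∧
      ∀ b : Fin n, pairValue ((Cmd.loop 2 (.write 2 (.idx 1 2) (.idx 1 2))).run n τ) (a, b) =
        pairCode (a, b) := by
    intro a τ ha
    have := Cmd.run_loop_induct (n := n) (p := .write 2 (.idx 1 2) (.idx 1 2)) (i := 2) (s := τ)
      (fun x τ' => τ'.reg 1 = a ∧ (∀ k, τ.arr 2 k = k → τ'.arr 2 k = k) ∧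
        ∀ b : Fin n, b.val < x → τ'.arr 2 (pairCode (a, b)) = pairCode (a, b))
      ⟨ha, fun _ => id, fun b hb => absurd hb (by omega)⟩ (by
        rintro x hx τ' ⟨h1, h2, h3⟩
        refine ⟨by simpa [Cmd.run] using h1, ?_, ?_⟩
        · intro k hk
          simp only [Cmd.run, Ram.State.setArr_arr, true_and]
          split_ifs with h
          · exact h.symm
          · exact h2 k hk
        · intro b hb
          simp only [Cmd.run, Ram.State.setArr_arr, true_and]
          split_ifs with h
          · exact h.symm
          · refine h3 b ?_
            rcases (Nat.lt_succ_iff.1 hb).lt_or_eq with h' | h'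
            · exact h'
            · exact absurd (by simp [Exp.eval_idx, pairCode, h1, h']) h)
    exact ⟨this.2.1, fun b => this.2.2 b b.2⟩
  have := Cmd.run_loop_induct (n := n) (p := .loop 2 (.write 2 (.idx 1 2) (.idx 1 2))) (i := 1)
    (s := s) (fun x τ => ∀ a : Fin n, a.val < x → ∀ b, pairValue τ (a, b) = pairCode (a, b))
    (fun a ha => absurd ha (by omega)) (by
      intro x hx τ hτ a ha b
      obtain ⟨h1, h2⟩ := inner ⟨x, hx⟩ (τ.setReg 1 x) (by simp)
      rcases (Nat.lt_succ_iff.1 ha).lt_or_eq with h | h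
      · exact h1 _ (hτ a h b)
      · obtain rfl : a = ⟨x, hx⟩ := Fin.ext h
        exact h2 b)
  exact this p.1 p.1.2 p.2

/-- Soundness makes the final value at p the code of a pair in its class; lowering along a chain
from any q in the class bounds it by the initial value at q, which is the code of q. -/
theorem isClassMin_relaxRounds {s : State} (hs : s.arr 0 = (Ram.graphInput G).arr 0) :
    IsClassMin G (pairValue ((Cmd.seq Cmd.initClasses Cmd.relaxRounds).run n s)) := by
  have h0 : (Cmd.initClasses.run n s).arr 0 = (Ram.graphInput G).arr 0 := by
    rw [Cmd.run_arr _ (by decide), hs]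
  have l := lowers_relaxRounds h0
  intro p
  refine ⟨l.sound (fun q => ⟨q, .refl q, pairValue_initClasses s q⟩) p, fun q hq => ?_⟩
  have := l.lower q p hq.symm.forcesWithin
  rwa [pairValue_initClasses] at this

end classes

open Ram (State)

/-! ### The interval ordering and the colouring -/

namespace Cmd

open Exp

/-- Array `3` counts the predecessors of each vertex. -/
def countPred : Cmd :=
  loop 1 (write 3 (var 1) (sum 2 (ind ((((var 2).ne (var 1)).and ((get 0 (idx 2 1)).not)).and
    ((get 2 (idx 2 1)).lt (get 2 (idx 1 2)))))))

/-- Array `4` contains the rank of each vertex. -/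
def computeRank : Cmd :=
  loop 1 (write 4 (var 1) (sum 2 (ind (((get 3 (var 2)).lt (get 3 (var 1))).or
    (((get 3 (var 2)).eq (get 3 (var 1))).and ((var 2).lt (var 1)))))))

/-- Array `5` contains the vertices in the order of their ranks. -/
def sortByRank : Cmd := loop 1 (write 5 (get 4 (var 1)) (var 1))

/-- Adjacent vertices `9` and `11` are not twins. -/
def notTwinExp : Exp :=
  sum 10 ((((var 10).ne (var 9)).and ((var 10).ne (var 11))).and
    ((get 0 (idx 9 10)).ne (get 0 (idx 11 10))))

/-- Colour `8` is forbidden for vertex `11` of rank `13`. -/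
def forbiddenExp : Exp :=
  sum 9 ((((get 4 (var 9)).lt (var 13)).and (get 0 (idx 9 11))).and
    (notTwinExp.and ((get 6 (var 9)).eq (var 8))))

/-- The least colour that is not forbidden. -/
def leastColourExp : Exp :=
  sum 7 (ind ((sum 8 (((var 7).lt (var 8)).not.and forbiddenExp.not)).not))

/-- First-fit colouring into array `6`. -/
def colour : Cmd := loop 13 (seq (assign 11 (get 5 (var 13))) (write 6 (var 11) leastColourExp))

/-- The part of the algorithm before the construction of the output. -/
def prepare : Cmd :=
  seq (seq initClasses relaxRounds) (seq countPred (seq computeRank (seq sortByRank colour)))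

end Cmd

section order

variable {n : ℕ} {G : SimpleGraph (Fin n)}

open Classical in
theorem arr_countPred {s : State} (hs : s.arr 0 = (Ram.graphInput G).arr 0) (v : Fin n) :
    (Cmd.countPred.run n s).arr 3 v =
      (Finset.univ.filter fun u => lexOrient G (pairValue s) u v).card := by
  refine Cmd.run_loop_write (f := fun x => if h : x < n then
    (Finset.univ.filter fun u => lexOrient G (pairValue s) u ⟨x, h⟩).card else 0) ?_ v.2 |>.trans
    (by simp)
  intro x hx τ _ harr hreg
  have h0 : τ.arr 0 = (Ram.graphInput G).arr 0 := (harr 0 (by omega)).trans hs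
  have h2 := harr 2 (by omega)
  simp only [hx, dif_pos, Exp.eval_sum, Exp.eval_ind, Finset.card_filter]
  refine Finset.sum_congr rfl fun u _ => if_congr ?_ rfl rfl
  have h0' : (τ.setReg 2 u).arr 0 = (Ram.graphInput G).arr 0 := h0
  have hadj := arr_zero_ne h0 u ⟨x, hx⟩
  simp only [Exp.holds_and, Exp.holds_ne, Exp.holds_not, Exp.holds_get, Exp.holds_lt,
    Exp.eval_get, Exp.eval_var, ne_eq, OfNat.ofNat_ne_zero, one_ne_zero, not_false_eq_true,
    Exp.eval_idx, Ram.State.setReg_reg, Ram.State.setReg_arr, if_true, hreg, h2,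
    OfNat.one_ne_ofNat, if_false, lexOrient, pairValue, pairCode, Fin.ext_iff] at hadj ⊢
  rw [hadj, and_assoc]

/-- The rank with respect to `P`, where ties are broken by the index. -/
noncomputable def rankBy (P : Fin n → ℕ) (v : Fin n) : ℕ :=
  (Finset.univ.filter fun w => P w < P v ∨ (P w = P v ∧ w < v)).card

theorem rankBy_lt {P : Fin n → ℕ} {u v : Fin n} (h : P u < P v ∨ (P u = P v ∧ u < v)) :
    rankBy P u < rankBy P v := by
  refine Finset.card_lt_card ((Finset.ssubset_iff_of_subset ?_).2 ⟨u, by simpa using h, by simp⟩)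
  intro x hx
  simp only [Finset.mem_filter, Finset.mem_univ, true_and] at hx ⊢
  rcases hx with h1 | ⟨h1, h1'⟩ <;> rcases h with h2 | ⟨h2, h2'⟩
  · exact Or.inl (h1.trans h2)
  · exact Or.inl (h2 ▸ h1)
  · exact Or.inl (h1 ▸ h2)
  · exact Or.inr ⟨h1.trans h2, h1'.trans h2'⟩

theorem rankBy_lt_iff {P : Fin n → ℕ} {u v : Fin n} :
    rankBy P u < rankBy P v ↔ P u < P v ∨ (P u = P v ∧ u < v) := by
  refine ⟨fun h => ?_, rankBy_lt⟩
  by_contra hcon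
  by_cases huv : u = v
  · subst huv
    exact lt_irrefl _ h
  · refine lt_asymm h (rankBy_lt ?_)
    have : u.val ≠ v.val := fun h => huv (Fin.ext h)
    simp only [Fin.lt_def] at hcon ⊢
    omega

theorem rankBy_injective (P : Fin n → ℕ) : Function.Injective (rankBy P) := by
  intro u v h
  by_contra huv
  have h1 := mt rankBy_lt_iff.2 (not_lt.2 h.le)
  have h2 := mt rankBy_lt_iff.2 (not_lt.2 h.ge)
  have : u.val ≠ v.val := fun h => huv (Fin.ext h)
  simp only [Fin.lt_def] at h1 h2
  omega

theorem rankBy_lt_size (P : Fin n → ℕ) (v : Fin n) : rankBy P v < n := by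
  have : rankBy P v < (Finset.univ : Finset (Fin n)).card :=
    Finset.card_lt_card ((Finset.ssubset_iff_of_subset (Finset.filter_subset _ _)).2
      ⟨v, Finset.mem_univ v, by simp⟩)
  simpa using this

theorem arr_computeRank {P : Fin n → ℕ} {s : State} (hs : ∀ v : Fin n, s.arr 3 v = P v)
    (v : Fin n) : (Cmd.computeRank.run n s).arr 4 v = rankBy P v := by
  classical
  refine Cmd.run_loop_write (f := fun x => if h : x < n then rankBy P ⟨x, h⟩ else 0) ?_ v.2 |>.trans
    (by simp)
  intro x hx τ _ harr hreg
  simp only [hx, dif_pos, Exp.eval_sum, Exp.eval_ind, rankBy, Finset.card_filter]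
  refine Finset.sum_congr rfl fun u _ => if_congr ?_ rfl rfl
  have hx' := hs ⟨x, hx⟩
  simp only at hx'
  simp [harr 3, hreg, hs, hx', Fin.lt_def]

theorem arr_sortByRank {R : Fin n → ℕ} (hR : Function.Injective R) {s : State}
    (hs : ∀ v : Fin n, s.arr 4 v = R v) (v : Fin n) :
    (Cmd.sortByRank.run n s).arr 5 (R v) = v := by
  refine (Cmd.run_loop_induct (n := n) (fun k τ => τ.arr 4 = s.arr 4 ∧
    ∀ v : Fin n, v.val < k → τ.arr 5 (R v) = v) ⟨rfl, fun v hv => absurd hv (by omega)⟩ ?_).2 v v.2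
  rintro k hk τ ⟨h1, h2⟩
  have hk' := hs ⟨k, hk⟩
  simp only at hk'
  refine ⟨by funext l; simp [Cmd.run, h1], fun w hw => ?_⟩
  simp only [Cmd.run, Ram.State.setArr_arr, true_and, Exp.eval_get, Exp.eval_var,
    Ram.State.setReg_reg, if_true, Ram.State.setReg_arr, h1, hk', hR.eq_iff, Fin.ext_iff]
  split_ifs with h
  · exact h.symm
  · exact h2 w (by omega)

/-- The interval property was shown under weak inequalities between predecessor counts, so ties may
be broken arbitrarily. -/
theorem IsClassMin.isIntervalRank {M : Fin n × Fin n → ℕ} (hM : IsClassMin G M)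
    (hG : G.IsMixedUnitInterval) {P : Fin n → ℕ}
    (hP : ∀ v, P v = by classical exact (Finset.univ.filter fun u => lexOrient G M u v).card) :
    IsIntervalRank G (rankBy P) where
  inj := rankBy_injective P
  adj {a b c} hab hbc hac := by
    rw [rankBy_lt_iff] at hab hbc
    refine hM.adj_of_card_le hG hP (b := b) (c := c) (by omega) (by omega) ?_ hac
    rintro rfl
    simp at hab

end order

section colouring

variable {n : ℕ} {G : SimpleGraph (Fin n)}

/-- The least number violating B is the number of x such that B holds up to and including x. This
expresses minimisation by a sum. -/
theorem leastColour_count {B : ℕ → Prop} [DecidablePred fun x : Fin n => ∀ y ≤ x.val, B y]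
    (hB : ∃ y < n, ¬ B y) {c : ℕ}
    (hc : c = (Finset.univ.filter fun x : Fin n => ∀ y ≤ x.val, B y).card) :
    ¬ B c ∧ ∀ y < c, B y := by
  classical
  set m := Nat.find (show ∃ y, ¬ B y from hB.imp fun _ h => h.2) with hm
  have h1 : ¬ B m := Nat.find_spec (show ∃ y, ¬ B y from hB.imp fun _ h => h.2)
  have h2 : ∀ y < m, B y := fun y hy => not_not.1 (Nat.find_min _ hy)
  obtain ⟨y, hy, hBy⟩ := hB
  have hmn : m < n := (Nat.find_min' _ hBy).trans_lt hy
  have : c = m := by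
    have heq : (Finset.univ.filter fun x : Fin n => ∀ y ≤ x.val, B y) = Finset.Iio ⟨m, hmn⟩ := by
      ext x
      simp only [Finset.mem_filter, Finset.mem_univ, true_and, Finset.mem_Iio, Fin.lt_def]
      refine ⟨fun h => ?_, fun h y hy => h2 y (by omega)⟩
      by_contra hcon
      exact h1 (h m (by omega))
    rw [hc, heq, Fin.card_Iio]
  rw [this]
  exact ⟨h1, h2⟩

/-- For adjacent w and v, the closed neighbourhoods agree at w and v themselves, so only the other
columns of the matrix need comparing. -/
theorem holds_notTwinExp {s : State} (hs : s.arr 0 = (Ram.graphInput G).arr 0) {w v : Fin n}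
    (hw : s.reg 9 = w) (hv : s.reg 11 = v) (hadj : G.Adj w v) :
    Cmd.notTwinExp.Holds n s ↔ ¬ G.IsTwin w v := by
  have key : ∀ z : Fin n, s.arr 0 (w * n + z) = s.arr 0 (v * n + z) ↔
      (G.Adj w z ↔ G.Adj v z) := by
    intro z
    rw [arr_zero_eq hs, arr_zero_eq hs]
    by_cases h1 : G.Adj w z <;> by_cases h2 : G.Adj v z <;> simp [h1, h2]
  simp only [Cmd.notTwinExp, Exp.holds_sum, Exp.holds_and, Exp.holds_ne, Exp.eval_var,
    Exp.eval_get, ne_eq, OfNat.ofNat_ne_zero, not_false_eq_true, Exp.eval_idx,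
    Ram.State.setReg_reg, Ram.State.setReg_arr, if_true, Nat.reduceEqDiff, if_false, hw, hv, key,
    SimpleGraph.isTwin_iff, Fin.val_inj, not_forall]
  refine exists_congr fun z => ?_
  by_cases h1 : z = w
  · subst h1
    simp [hadj.symm]
  · by_cases h2 : z = v
    · subst h2
      simp [hadj]
    · simp [h1, h2]

theorem holds_forbiddenExp {s : State} (hs : s.arr 0 = (Ram.graphInput G).arr 0)
    {R : Fin n → ℕ} (hR : ∀ v : Fin n, s.arr 4 v = R v) {v : Fin n} (hv : s.reg 11 = v)
    (hk : s.reg 13 = R v) :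
    Cmd.forbiddenExp.Holds n s ↔
      ∃ w : Fin n, R w < R v ∧ G.Adj w v ∧ ¬ G.IsTwin w v ∧ s.arr 6 w = s.reg 8 := by
  simp only [Cmd.forbiddenExp, Exp.holds_sum, Exp.holds_and]
  refine exists_congr fun w => ?_
  have h1 : ((Exp.get 4 (.var 9)).lt (.var 13)).Holds n (s.setReg 9 w) ↔ R w < R v := by
    simp [hR, hk]
  have h2 : (Exp.get 0 (.idx 9 11)).Holds n (s.setReg 9 w) ↔ G.Adj w v := by
    rw [← arr_zero_ne hs]
    simp [Exp.eval_idx, hv]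
  have h3 : ((Exp.get 6 (.var 9)).eq (.var 8)).Holds n (s.setReg 9 w) ↔
      s.arr 6 w = s.reg 8 := by
    simp
  rw [h1, h2, h3, and_assoc]
  refine and_congr_right fun _ => and_congr_right fun hadj => ?_
  rw [holds_notTwinExp (s := s.setReg 9 w) (w := w) (v := v) hs (by simp) (by simpa using hv) hadj]

theorem eval_leastColourExp {s : State} (hs : s.arr 0 = (Ram.graphInput G).arr 0)
    {R : Fin n → ℕ} (hR : ∀ v : Fin n, s.arr 4 v = R v) {v : Fin n} (hv : s.reg 11 = v)
    (hk : s.reg 13 = R v) :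
    let B : ℕ → Prop := fun y =>
      ∃ w : Fin n, R w < R v ∧ G.Adj w v ∧ ¬ G.IsTwin w v ∧ s.arr 6 w = y
    ¬ B (Cmd.leastColourExp.eval n s) ∧ ∀ y < Cmd.leastColourExp.eval n s, B y := by
  classical
  intro B
  refine leastColour_count (n := n) ?_ ?_
  -- Pigeonhole: n forbidden colours would need n distinct vertices other than v.
  · by_contra! hcon
    have hsub : (Finset.range n) ⊆ (Finset.univ.erase v).image fun w : Fin n => s.arr 6 w := by
      intro y hy
      obtain ⟨w, hw, -, -, h⟩ := hcon y (Finset.mem_range.1 hy)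
      refine Finset.mem_image.2 ⟨w, ?_, h⟩
      rw [Finset.mem_erase]
      refine ⟨?_, Finset.mem_univ w⟩
      rintro rfl
      exact lt_irrefl _ hw
    have h1 := (Finset.card_le_card hsub).trans Finset.card_image_le
    rw [Finset.card_range, Finset.card_erase_of_mem (Finset.mem_univ v), Finset.card_univ,
      Fintype.card_fin] at h1
    have := v.2
    omega
  · simp only [Cmd.leastColourExp, Exp.eval_sum, Exp.eval_ind, Finset.card_filter]
    refine Finset.sum_congr rfl fun x _ => if_congr ?_ rfl rfl
    rw [Exp.holds_not, Exp.holds_sum]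
    push Not
    have key : ∀ y : Fin n, (((Exp.var 7).lt (.var 8)).not.and Cmd.forbiddenExp.not).Holds n
        ((s.setReg 7 x).setReg 8 y) ↔ y.val ≤ x ∧ ¬ B y := by
      intro y
      rw [Exp.holds_and, Exp.holds_not, Exp.holds_not,
        holds_forbiddenExp (s := (s.setReg 7 x).setReg 8 y) (G := G) (R := R) (v := v) hs hR (by simpa using hv) (by simpa using hk)]
      simp [B]
    simp only [key, not_and, not_not]
    exact ⟨fun h y hy => h ⟨y, by omega⟩ hy, fun h y => h y⟩

/-- Round k writes only the colour of the vertex of rank k. The condition at a vertex refers to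
colours of earlier ranks, which are final by then. -/
theorem isFirstFit_colour {s : State} (hs : s.arr 0 = (Ram.graphInput G).arr 0)
    {R : Fin n → ℕ} (hinj : Function.Injective R) (hlt : ∀ v, R v < n)
    (hR : ∀ v : Fin n, s.arr 4 v = R v) (hS : ∀ v : Fin n, s.arr 5 (R v) = v) :
    IsFirstFit G R fun v => (Cmd.colour.run n s).arr 6 v := by
  have := Cmd.run_loop_induct (n := n) (i := 13)
    (p := .seq (.assign 11 (.get 5 (.var 13))) (.write 6 (.var 11) Cmd.leastColourExp)) (s := s)
    (fun k τ => (∀ A, A ≠ 6 → τ.arr A = s.arr A) ∧ ∀ v : Fin n, R v < k →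
      (∀ w : Fin n, R w < R v → G.Adj w v → ¬ G.IsTwin w v → τ.arr 6 w ≠ τ.arr 6 v) ∧
      ∀ y < τ.arr 6 v, ∃ w : Fin n, R w < R v ∧ G.Adj w v ∧ ¬ G.IsTwin w v ∧ τ.arr 6 w = y)
    ⟨fun _ _ => rfl, fun v hv => absurd hv (by omega)⟩ (by
      rintro k hk τ ⟨h1, h2⟩
      have hinj' : Function.Injective fun v : Fin n => (⟨R v, hlt v⟩ : Fin n) :=
        fun a b h => hinj (Fin.mk.inj h)
      obtain ⟨u, hu⟩ := (Finite.injective_iff_surjective.1 hinj') ⟨k, hk⟩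
      replace hu : R u = k := Fin.mk.inj hu
      set τ' : State := (τ.setReg 13 k).setReg 11 u with hτ'
      have hval : (Exp.get 5 (.var 13)).eval n (τ.setReg 13 k) = u := by
        simp [h1 5, ← hu, hS]
      have hc := eval_leastColourExp (G := G) (s := τ') (R := R) (v := u)
        ((h1 0 (by omega)).trans hs) (fun v => by simp [hτ', h1 4, hR]) (by simp [hτ'])
        (by simp [hτ', hu])
      set col := Cmd.leastColourExp.eval n τ' with hcol
      have hrun : (Cmd.seq (.assign 11 (.get 5 (.var 13)))
          (.write 6 (.var 11) Cmd.leastColourExp)).run n (τ.setReg 13 k) = τ'.setArr 6 u col := by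
        simp only [Cmd.run, hval, ← hτ', ← hcol]
        simp [hτ']
      rw [hrun]
      refine ⟨fun A hA => by funext l; simp [hA, hτ', h1 A hA], fun v hv => ?_⟩
      have hold : ∀ w : Fin n, R w < k → (τ'.setArr 6 u col).arr 6 w = τ.arr 6 w := by
        intro w hw
        have : w ≠ u := by
          rintro rfl
          omega
        simp [hτ', Fin.val_inj, this]
      rcases (Nat.lt_succ_iff.1 hv).lt_or_eq with h | h
      · obtain ⟨h3, h4⟩ := h2 v h
        rw [hold v h]
        refine ⟨fun w hw ha ht => ?_, fun y hy => ?_⟩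
        · rw [hold w (hw.trans h)]
          exact h3 w hw ha ht
        · obtain ⟨w, hw, ha, ht, hy⟩ := h4 y hy
          exact ⟨w, hw, ha, ht, by rw [hold w (hw.trans h), hy]⟩
      · obtain rfl : v = u := hinj (h.trans hu.symm)
        have hnew : (τ'.setArr 6 v col).arr 6 v = col := by simp
        rw [hnew]
        refine ⟨fun w hw ha ht h' => ?_, fun y hy => ?_⟩
        · rw [hold w (by omega)] at h'
          exact hc.1 ⟨w, hw, ha, ht, h'⟩
        · obtain ⟨w, hw, ha, ht, hy⟩ := hc.2 y hy
          exact ⟨w, hw, ha, ht, by rw [hold w (by omega)]; exact hy⟩)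
  exact fun v => this.2 v (hlt v)

/-- The arrays contain an interval ordering and a first-fit colouring. -/
structure Tables {n : ℕ} (G : SimpleGraph (Fin n)) (R c : Fin n → ℕ) (s : State) : Prop where
  graph : s.arr 0 = (Ram.graphInput G).arr 0
  rank : ∀ v : Fin n, s.arr 4 v = R v
  sorted : ∀ v : Fin n, s.arr 5 (R v) = v
  colour : ∀ v : Fin n, s.arr 6 v = c v

theorem exists_tables_prepare (hG : G.IsMixedUnitInterval) :
    ∃ R c : Fin n → ℕ, IsIntervalRank G R ∧ (∀ v, R v < n) ∧ IsFirstFit G R c ∧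
      Tables G R c (Cmd.prepare.run n (initialStore G)) := by
  classical
  set s₁ := (Cmd.seq Cmd.initClasses Cmd.relaxRounds).run n (initialStore G) with hs₁
  set s₂ := Cmd.countPred.run n s₁ with hs₂
  set s₃ := Cmd.computeRank.run n s₂ with hs₃
  set s₄ := Cmd.sortByRank.run n s₃ with hs₄
  have hrun : Cmd.prepare.run n (initialStore G) = Cmd.colour.run n s₄ := rfl
  have hM : IsClassMin G (pairValue s₁) := isClassMin_relaxRounds rfl
  have g₁ : s₁.arr 0 = (Ram.graphInput G).arr 0 := by
    rw [hs₁, Cmd.run_arr _ (by decide)]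
    rfl
  have g₄ : s₄.arr 0 = (Ram.graphInput G).arr 0 := by
    rw [hs₄, Cmd.run_arr _ (by decide), hs₃, Cmd.run_arr _ (by decide), hs₂,
      Cmd.run_arr _ (by decide), g₁]
  set P : Fin n → ℕ := fun v => (Finset.univ.filter fun u => lexOrient G (pairValue s₁) u v).card
    with hP
  have hrank : IsIntervalRank G (rankBy P) := hM.isIntervalRank hG fun v => rfl
  have r₃ : ∀ v : Fin n, s₃.arr 4 v = rankBy P v := arr_computeRank fun v => arr_countPred g₁ v
  have r₄ : ∀ v : Fin n, s₄.arr 4 v = rankBy P v := by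
    intro v
    rw [hs₄, Cmd.run_arr _ (by decide), r₃]
  have o₄ : ∀ v : Fin n, s₄.arr 5 (rankBy P v) = v := arr_sortByRank hrank.inj r₃
  refine ⟨rankBy P, _, hrank, rankBy_lt_size P,
    isFirstFit_colour g₄ hrank.inj (rankBy_lt_size P) r₄ o₄, ?_, ?_, ?_, fun v => by rw [hrun]⟩
  · rw [hrun, Cmd.run_arr _ (by decide), g₄]
  · intro v
    rw [hrun, Cmd.run_arr _ (by decide), r₄]
  · intro v
    rw [hrun, Cmd.run_arr _ (by decide), o₄]

end colouring

open Ram (State)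

/-! ### The output -/

namespace Cmd

open Exp

/-- Append the values of expressions to the output; variable `6` contains its length. -/
def emit : List Exp → Cmd
  | [] => skip
  | e :: l => seq (seq (write 1 (var 6) e) (assign 6 (add (var 6) (lit 1)))) (emit l)

/-- The label of the vertex in a variable. -/
def labelExp (x : ℕ) : Exp := add (get 6 (var x)) (lit 1)

/-- Relabel by `0` the earlier vertices that are not adjacent to the new vertex `11`; the previous
vertex is `12`. -/
def emitRelabel : Cmd :=
  loop 8 (ite (((get 4 (var 8)).lt (var 13)).and
      ((((var 8).eq (var 12)).or (get 0 (idx 8 12))).and (get 0 (idx 8 11)).not))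
    (emit [lit 3, labelExp 8, lit 0]) skip)

/-- Connect the new vertex `11` with its earlier neighbours. -/
def emitJoin : Cmd :=
  loop 8 (ite (((get 4 (var 8)).lt (var 13)).and (get 0 (idx 8 11)))
    (emit [lit 2, labelExp 11, labelExp 8]) skip)

/-- The output for a vertex that is not the first one. -/
def emitNext : Cmd :=
  seq (seq (assign 11 (get 5 (var 13))) (assign 12 (get 5 (sub (var 13) (lit 1)))))
    (seq emitRelabel (seq (emit [lit 0, labelExp 11, var 11, lit 1]) emitJoin))

/-- The construction of the output. -/
def emitAll : Cmd :=
  seq (seq (assign 11 (get 5 (lit 0))) (emit [lit 0, labelExp 11, var 11]))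
    (loop 13 (ite (var 13) emitNext skip))

/-- The complete algorithm. -/
def decompose : Cmd := seq prepare emitAll

end Cmd

/-- The word `w` has been written to the output. -/
def Written (w : List ℕ) (s : State) : Prop :=
  s.reg 6 = w.length ∧ ∀ k (h : k < w.length), s.arr 1 k = w[k]

/-- The value of an expression depends neither on the output nor on its length. -/
def Exp.Stable (n : ℕ) (e : Exp) : Prop :=
  ∀ s s' : State, (∀ r, r ≠ 6 → s'.reg r = s.reg r) → (∀ A, A ≠ 1 → s'.arr A = s.arr A) →
    e.eval n s' = e.eval n s

section output

variable {n : ℕ} {G : SimpleGraph (Fin n)} {R c : Fin n → ℕ}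

theorem Exp.stable_lit (x : ℕ) : (Exp.lit x).Stable n := fun _ _ _ _ => rfl

theorem Exp.stable_var {x : ℕ} (hx : x ≠ 6) : (Exp.var x).Stable n := fun _ _ h _ => h x hx

theorem Exp.stable_labelExp {x : ℕ} (hx : x ≠ 6) : (Cmd.labelExp x).Stable n := by
  intro s s' h h'
  simp [Cmd.labelExp, h x hx, h' 6]

/-- The two stores agree except for the output and its length. -/
def SameInputs (s s' : State) : Prop :=
  (∀ r, r ≠ 6 → s'.reg r = s.reg r) ∧ ∀ A, A ≠ 1 → s'.arr A = s.arr A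

/-- Each append changes the output array and its length; stability allows all values to be computed
in the initial store. -/
theorem Written.emit {l : List Exp} (hl : ∀ e ∈ l, e.Stable n) {w : List ℕ} {s : State}
    (h : Written w s) :
    Written (w ++ l.map fun e => e.eval n s) ((Cmd.emit l).run n s) ∧
      SameInputs s ((Cmd.emit l).run n s) := by
  induction l generalizing w s with
  | nil => simpa [Cmd.emit, Cmd.run, SameInputs] using h
  | cons e l ih =>
    set s' := (s.setArr 1 (s.reg 6) (e.eval n s)).setReg 6 (s.reg 6 + 1) with hs'
    have hrun : (Cmd.emit (e :: l)).run n s = (Cmd.emit l).run n s' := by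
      simp [Cmd.emit, Cmd.run, hs']
    have hin : SameInputs s s' := by
      refine ⟨fun r hr => by simp [hs', hr], fun A hA => ?_⟩
      funext k
      simp [hs', hA]
    have hw : Written (w ++ [e.eval n s]) s' := by
      refine ⟨by simp [hs', h.1], fun k hk => ?_⟩
      simp only [hs', Ram.State.setReg_arr, Ram.State.setArr_arr, true_and, h.1]
      split_ifs with hkw
      · subst hkw
        simp
      · have : k < w.length := by
          simp only [List.length_append, List.length_singleton] at hk
          omega
        rw [List.getElem_append_left this]
        exact h.2 k this
    obtain ⟨h1, h2⟩ := ih (fun e' he' => hl e' (List.mem_cons_of_mem _ he')) hw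
    rw [hrun]
    refine ⟨?_, fun r hr => (h2.1 r hr).trans (hin.1 r hr),
      fun A hA => (h2.2 A hA).trans (hin.2 A hA)⟩
    have hmap : (l.map fun e => e.eval n s') = l.map fun e => e.eval n s :=
      List.map_congr_left fun e' he' => hl e' (List.mem_cons_of_mem _ he') s s' hin.1 hin.2
    rw [hmap, List.append_assoc] at h1
    simpa using h1

theorem Tables.of_arr {s s' : State} (h : Tables G R c s)
    (hs : ∀ A, A ≠ 1 → s'.arr A = s.arr A) : Tables G R c s' :=
  ⟨by rw [hs 0 (by omega), h.graph], fun v => by rw [hs 4 (by omega), h.rank],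
    fun v => by rw [hs 5 (by omega), h.sorted], fun v => by rw [hs 6 (by omega), h.colour]⟩

/-- The vertices that the loops for the output refer to. -/
structure Current (G : SimpleGraph (Fin n)) (R c : Fin n → ℕ) (p u : Fin n) (s : State) :
    Prop extends Tables G R c s where
  new : s.reg 11 = u
  prev : s.reg 12 = p
  step : s.reg 13 = R u

theorem Current.of_sameInputs {p u : Fin n} {s s' : State} (h : Current G R c p u s)
    (hs : SameInputs s s') : Current G R c p u s' :=
  ⟨h.toTables.of_arr hs.2, by rw [hs.1 11 (by omega), h.new], by rw [hs.1 12 (by omega), h.prev],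
    by rw [hs.1 13 (by omega), h.step]⟩

theorem Current.setReg {p u : Fin n} {s : State} (h : Current G R c p u s) (x : ℕ) :
    Current G R c p u (s.setReg 8 x) :=
  ⟨h.toTables.of_arr fun _ _ => rfl, by simp [h.new], by simp [h.prev], by simp [h.step]⟩

/-- The invariant pairs the output with an expression that it encodes: in postfix notation,
appending three numbers applies one relabelling to that expression. -/
theorem Current.emitRelabel {m : ℕ} {p u : Fin n} {s : State} {T : CliqueExpr (Fin n)}
    (h : Current G R c p u s) (hR : IsIntervalRank G R) (hc : IsFirstFit G R c)
    (hm : ∀ v, c v + 1 < m) (hu : R u = R p + 1) (hw : Written T.encode s)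
    (hT : CliqueExpr.Relabelled G R c m p u 0 T) :
    ∃ T', CliqueExpr.Relabelled G R c m p u n T' ∧
      Written T'.encode (Cmd.emitRelabel.run n s) ∧
      Current G R c p u (Cmd.emitRelabel.run n s) := by
  refine Cmd.run_loop_induct (n := n) (fun x τ => ∃ T', CliqueExpr.Relabelled G R c m p u x T' ∧
    Written T'.encode τ ∧ Current G R c p u τ) ⟨T, hT, hw, h⟩ ?_
  rintro x hx τ ⟨T', hT', hw', h'⟩
  set w : Fin n := ⟨x, hx⟩ with hw_def
  set τ' := τ.setReg 8 x with hτ'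
  have h'' : Current G R c p u τ' := h'.setReg x
  have hwr : Written T'.encode τ' := by simpa [Written, hτ'] using hw'
  have h8 : τ'.reg 8 = w := by simp [hτ', hw_def]
  have hcond : (((Exp.get 4 (.var 8)).lt (.var 13)).and
      ((((Exp.var 8).eq (.var 12)).or (.get 0 (.idx 8 12))).and
        (Exp.get 0 (.idx 8 11)).not)).Holds n τ' ↔
      R w ≤ R p ∧ (w = p ∨ G.Adj w p) ∧ ¬ G.Adj w u := by
    simp only [Exp.holds_and, Exp.holds_lt, Exp.holds_or, Exp.holds_eq, Exp.holds_not,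
      Exp.holds_get, Exp.eval_get, Exp.eval_var, ne_eq, OfNat.ofNat_ne_zero, not_false_eq_true,
      Exp.eval_idx, h8, h''.new, h''.prev, h''.step, h''.rank, Fin.val_inj]
    rw [← ne_eq, ← ne_eq, arr_zero_ne h''.graph, arr_zero_ne h''.graph, hu, Nat.lt_succ_iff]
  rw [Cmd.run_ite]
  split_ifs with hif <;> rw [hcond] at hif
  · obtain ⟨h1, h2⟩ := hwr.emit (n := n) (l := [.lit 3, Cmd.labelExp 8, .lit 0]) (by
      simp only [List.mem_cons, List.not_mem_nil, or_false]
      rintro e (rfl | rfl | rfl)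
      · exact Exp.stable_lit 3
      · exact Exp.stable_labelExp (by omega)
      · exact Exp.stable_lit 0)
    refine ⟨.relabel (c w + 1) 0 T', hT'.step hR hc hm hu hif.1 hif.2.1 hif.2.2, ?_,
      h''.of_sameInputs h2⟩
    simpa [Cmd.labelExp, h8, h''.colour, CliqueExpr.encode] using h1
  · exact ⟨T', hT'.skip hif, hwr, h''⟩

theorem Current.emitJoin {m : ℕ} {p u : Fin n} {s : State} {T : CliqueExpr (Fin n)}
    (h : Current G R c p u s) (hm : ∀ v, c v + 1 < m) (hw : Written T.encode s)
    (hT : CliqueExpr.Joined G R c m u 0 T) :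
    ∃ T', CliqueExpr.Joined G R c m u n T' ∧
      Written T'.encode (Cmd.emitJoin.run n s) ∧
      Current G R c p u (Cmd.emitJoin.run n s) := by
  refine Cmd.run_loop_induct (n := n) (fun x τ => ∃ T', CliqueExpr.Joined G R c m u x T' ∧
    Written T'.encode τ ∧ Current G R c p u τ) ⟨T, hT, hw, h⟩ ?_
  rintro x hx τ ⟨T', hT', hw', h'⟩
  set w : Fin n := ⟨x, hx⟩ with hw_def
  set τ' := τ.setReg 8 x with hτ'
  have h'' : Current G R c p u τ' := h'.setReg x
  have hwr : Written T'.encode τ' := by simpa [Written, hτ'] using hw'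
  have h8 : τ'.reg 8 = w := by simp [hτ', hw_def]
  have hcond : (((Exp.get 4 (.var 8)).lt (.var 13)).and (.get 0 (.idx 8 11))).Holds n τ' ↔
      R w < R u ∧ G.Adj w u := by
    simp only [Exp.holds_and, Exp.holds_lt, Exp.holds_get, Exp.eval_get, Exp.eval_var, ne_eq,
      OfNat.ofNat_ne_zero, not_false_eq_true, Exp.eval_idx, h8, h''.new, h''.step, h''.rank]
    rw [← ne_eq, arr_zero_ne h''.graph]
  rw [Cmd.run_ite]
  split_ifs with hif <;> rw [hcond] at hif
  · obtain ⟨h1, h2⟩ := hwr.emit (n := n) (l := [.lit 2, Cmd.labelExp 11, Cmd.labelExp 8]) (by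
      simp only [List.mem_cons, List.not_mem_nil, or_false]
      rintro e (rfl | rfl | rfl)
      · exact Exp.stable_lit 2
      · exact Exp.stable_labelExp (by omega)
      · exact Exp.stable_labelExp (by omega))
    refine ⟨.join (c u + 1) (c w + 1) T', hT'.step hm hif.1 hif.2, ?_, h''.of_sameInputs h2⟩
    simpa [Cmd.labelExp, h8, h''.new, h''.colour, CliqueExpr.encode] using h1
  · exact ⟨T', hT'.skip hif, hwr, h''⟩

theorem Tables.emitNext {m : ℕ} {p u : Fin n} {s : State} {T : CliqueExpr (Fin n)}
    (h : Tables G R c s) (hR : IsIntervalRank G R) (hc : IsFirstFit G R c)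
    (hm : ∀ v, c v + 1 < m) (hu : R u = R p + 1) (hs : s.reg 13 = R u)
    (hw : Written T.encode s) (hT : CliqueExpr.Built G R c m p T) :
    ∃ T', CliqueExpr.Built G R c m u T' ∧ Written T'.encode (Cmd.emitNext.run n s) ∧
      Tables G R c (Cmd.emitNext.run n s) := by
  set s₁ := (s.setReg 11 u).setReg 12 p with hs₁
  have hrun : Cmd.emitNext.run n s = Cmd.emitJoin.run n
      ((Cmd.emit [.lit 0, Cmd.labelExp 11, .var 11, .lit 1]).run n
        (Cmd.emitRelabel.run n s₁)) := by
    have hp : R p = R u - 1 := by omega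
    simp [Cmd.emitNext, Cmd.run, hs, h.sorted, ← hp, ← hs₁]
  have h₁ : Current G R c p u s₁ :=
    ⟨h.of_arr fun _ _ => rfl, by simp [hs₁], by simp [hs₁], by simp [hs₁, hs]⟩
  obtain ⟨T₁, hT₁, hw₁, h₂⟩ := h₁.emitRelabel hR hc hm hu (by simpa [Written, hs₁] using hw)
    (hT.relabelled hR hu)
  obtain ⟨hw₂, hin⟩ := hw₁.emit (n := n) (l := [.lit 0, Cmd.labelExp 11, .var 11, .lit 1]) (by
      simp only [List.mem_cons, List.not_mem_nil, or_false]
      rintro e (rfl | rfl | rfl | rfl)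
      · exact Exp.stable_lit 0
      · exact Exp.stable_labelExp (by omega)
      · exact Exp.stable_var (by omega)
      · exact Exp.stable_lit 1)
  obtain ⟨T₂, hT₂, hw₃, h₃⟩ := (h₂.of_sameInputs hin).emitJoin hm
    -- The four numbers just appended are the three of the new vertex and the symbol for the union.
    (T := .union T₁ (.vertex (c u + 1) u))
    (by simpa [Cmd.labelExp, h₂.new, h₂.colour, CliqueExpr.encode] using hw₂)
    (hT₁.union hR hm hu)
  rw [hrun]
  exact ⟨T₂, hT₂.built hR, hw₃, h₃.toTables⟩

theorem Tables.emitAll {m : ℕ} {s : State} (hn : 0 < n) (h : Tables G R c s)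
    (hR : IsIntervalRank G R) (hlt : ∀ v, R v < n) (hc : IsFirstFit G R c)
    (hm : ∀ v, c v + 1 < m) (hs : s.reg 6 = 0) :
    ∃ p T, CliqueExpr.Built G R c m p T ∧ (∀ v, R v ≤ R p) ∧
      Written T.encode (Cmd.emitAll.run n s) := by
  have hsurj : ∀ k < n, ∃ u, R u = k := by
    intro k hk
    have hinj' : Function.Injective fun v : Fin n => (⟨R v, hlt v⟩ : Fin n) :=
      fun a b h => hR.inj (Fin.mk.inj h)
    obtain ⟨u, hu⟩ := (Finite.injective_iff_surjective.1 hinj') ⟨k, hk⟩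
    exact ⟨u, Fin.mk.inj hu⟩
  obtain ⟨p₀, hp₀⟩ := hsurj 0 hn
  set s₁ := s.setReg 11 p₀ with hs₁
  have hsort : s.arr 5 0 = p₀ := by
    rw [← hp₀]
    exact h.sorted p₀
  have h₁ : Tables G R c s₁ := h.of_arr fun _ _ => rfl
  have hw₁ : Written [] s₁ := ⟨by simp [hs₁, hs], fun k hk => absurd hk (by simp)⟩
  obtain ⟨hw₂, hin⟩ := hw₁.emit (n := n) (l := [.lit 0, Cmd.labelExp 11, .var 11]) (by
      simp only [List.mem_cons, List.not_mem_nil, or_false]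
      rintro e (rfl | rfl | rfl)
      · exact Exp.stable_lit 0
      · exact Exp.stable_labelExp (by omega)
      · exact Exp.stable_var (by omega))
  set s₂ := (Cmd.emit [.lit 0, Cmd.labelExp 11, .var 11]).run n s₁ with hs₂
  have hrun : Cmd.emitAll.run n s =
      (Cmd.loop 13 (.ite (.var 13) Cmd.emitNext .skip)).run n s₂ := by
    rw [Cmd.emitAll, Cmd.run, Cmd.run, Cmd.run, Exp.eval_get, Exp.eval_lit, hsort]
  have hw₂' : Written (CliqueExpr.vertex (c p₀ + 1) p₀).encode s₂ := by
    simpa [Cmd.labelExp, hs₁, h.colour, CliqueExpr.encode] using hw₂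
  have key := Cmd.run_loop_induct (n := n) (i := 13) (p := .ite (.var 13) Cmd.emitNext .skip)
    -- The vertex of rank 0 is written before the loop and round 0 does nothing, so with truncated
    -- subtraction the invariant names that vertex for both k = 0 and k = 1.
    (s := s₂) (fun k τ => Tables G R c τ ∧ ∃ p T, R p = k - 1 ∧
      CliqueExpr.Built G R c m p T ∧ Written T.encode τ)
    ⟨h₁.of_arr hin.2, p₀, _, hp₀, CliqueExpr.built_vertex hR hp₀ (hm p₀), hw₂'⟩ (by
      rintro k hk τ ⟨hτ, p, T, hp, hT, hw⟩
      have hτ' : Tables G R c (τ.setReg 13 k) := hτ.of_arr fun _ _ => rfl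
      have hw' : Written T.encode (τ.setReg 13 k) := by simpa [Written] using hw
      rw [Cmd.run_ite]
      by_cases hk0 : k = 0
      · rw [if_neg (by simp [hk0])]
        exact ⟨hτ', p, T, by omega, hT, hw'⟩
      · rw [if_pos (by simpa using hk0)]
        obtain ⟨u, hu⟩ := hsurj k hk
        obtain ⟨T', hT', hw'', hτ''⟩ := hτ'.emitNext (p := p) (u := u) hR hc hm (by omega)
          (by simp [hu]) hw' hT
        exact ⟨hτ'', u, T', by omega, hT', hw''⟩)
  obtain ⟨-, p, T, hp, hT, hw⟩ := key
  refine ⟨p, T, hT, fun v => ?_, hrun ▸ hw⟩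
  have := hlt v
  omega

end output

/-- There is a polynomial-time algorithm that, given a (non-empty) mixed unit interval graph `G`,
outputs a `(1,1,1)`-clique-width decomposition of `G` of width at most `2 p(G) + 1`. -/
theorem mainTheorem7 :
    ∃ (P : Ram) (q : Polynomial ℕ), ∀ (n : ℕ), 0 < n → ∀ G : SimpleGraph (Fin n),
      G.IsMixedUnitInterval →
      ∃ T : CliqueExpr (Fin n),
        T.IsABDDecomposition G 1 1 1 ∧
        T.width ≤ 2 * G.bubbleP + 1 ∧
        ∃ (s : Ram.State) (t : ℕ), Ram.Exec P (Ram.graphInput G) s t ∧ t ≤ q.eval n ∧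
          Ram.HoldsOutput s T.encode := by
  obtain ⟨P, q, hPq⟩ := Cmd.exists_ram Cmd.decompose 6
  refine ⟨P, q, fun n hn G hG => ?_⟩
  obtain ⟨R, c, hR, hlt, hc, ht⟩ := exists_tables_prepare hG
  -- The available labels are 0 and the colours below 2 p(G), shifted by one.
  obtain ⟨p, T, hT, hp, hw⟩ := ht.emitAll (m := 2 * G.bubbleP + 1) hn hR hlt hc
    (fun v => Nat.succ_lt_succ (hc.lt_two_mul_bubbleP hR hG v)) (by
      rw [Cmd.run_reg _ (by decide)]
      rfl)
  exact ⟨T, hT.isABDDecomposition hR hc hp, hT.tame.width_le, hPq n G T.encode hw.1 hw.2⟩
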